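/- Let $\mathbb O$ be the octonions with standard basis $e_0=1,e_1,\dots,e_7$. An $\mathbb O$-bimodule is a real vector space with unital real-bilinear left and right multiplications by $\mathbb O$ whose associators satisfy $[p,q,x]=[q,x,p]=[x,p,q]=-[q,p,x]$; put $\operatorname{Re}M=\{m:[p,q,m]=0\ \forall p,q\in\mathbb O\}$, with projection $\operatorname{Re}m=\frac5{12}m-\frac1{12}\sum_{i=1}^7 e_ime_i$. For a real-linear map $g$ put $B_p(g,x)=g(x)p-g(xp)$; $g$ is (right) para-linear if $\operatorname{Re}B_p(g,x)=0$ for all $p,x$. Let $(g\odot p)(x)=g(px)-B_p(g,x)$. A Hilbert $\mathbb O$-bimodule $H$ is an $\mathbb O$-bimodule with a real-bilinear map $\langle\cdot,\cdot\rangle:H\times H\to\mathbb O$ that is para-linear in the second variable and satisfies $\langle u,v\rangle=\overline{\langle v,u\rangle}$ and $\langle u,u\rangle=\|u\|^2\ge 0$, with equality to $0$ only for $u=0$, and that is complete in this norm. Its slice cone is $\mathbb C(H)=\bigcup_J(\operatorname{Re}H+J\operatorname{Re}H)$, $J$ running over the unit imaginary octonions. For $z\in\mathbb C(H)$ let $P_z(x)=z\langle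 z,x\rangle$. A strong eigenvector of $T$ with strong eigenvalue $\lambda\in\mathbb O$ is a nonzero $z\in\mathbb C(H)$ with $Tz=z\lambda$. A family $(x_a)$ in $H$ is weak associative orthonormal if $\langle x_a,x_b\rangle=\delta_{ab}$ and $\langle x_a,x_b\rangle p=\langle x_a,x_bp\rangle$ for all $p\in\mathbb O$ and all $a,b$; it is a weak associative orthonormal basis if it is a maximal such family. Theorem. Let $H$ be a Hilbert $\mathbb O$-bimodule and let $T:H\to H$ be a bounded real-linear operator that is compact, para-linear and self-adjoint (that is, symmetric for the real inner product $\operatorname{Re}\langle\cdot,\cdot\rangle$). Let $\sigma(T)\subset\mathbb R$ consist of $0$ and the real strong eigenvalues of $T$, and let $f:\sigma(T)\to\mathbb O$ be bounded. For a weak associative orthonormal basis $\{z_i\}_{i\in N}\cup\{z_\alpha\}_{\alpha\in\Lambda}$ of $H$ consisting of strong eigenvectors of $T$, with $Tz_i=z_i\lambda_i$, $\lambda_i\in\mathbb R\setminus\{0\}$, and $Tz_\alpha=0$, put $$P_0=\sum_{\alpha\in\Lambda}P_{z_\alpha},\qquad \Phi(f)(x)=(P_0\odot f(0))(x)+\sum_{i\in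 N}(P_{z_i}\odot f(\lambda_i))(x)\qquad(x\in H).$$ Then, for every such basis, these series converge unconditionally at every point of $H$ and $\Phi(f)$ is a bounded para-linear operator; and $\Phi(f)$ does not depend on the basis: any two such bases give the same operator $\Phi(f)$. -/

import Mathlib

/-- The octonions `𝕆`, with their Euclidean norm `|x|`; `x i` is the coordinate of `x` along `e i`,
where `e 0 = 1`. -/
abbrev Octonion : Type := EuclideanSpace ℝ (Fin 8)

namespace Octonion

/-- The octonion product: `e 0` is the unit and `e i * e j = ε i j k • e k - δ i j` for `i, j ≥ 1`,
where `ε` is totally antisymmetric with value `1` on the oriented triples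
`123`, `145`, `176`, `246`, `257`, `347`, `365`. -/
noncomputable instance instMul : Mul Octonion where
  mul x y := !₂[
    x 0 * y 0 - x 1 * y 1 - x 2 * y 2 - x 3 * y 3 - x 4 * y 4 - x 5 * y 5 - x 6 * y 6 - x 7 * y 7,
    x 0 * y 1 + x 1 * y 0 + x 2 * y 3 - x 3 * y 2 + x 4 * y 5 - x 5 * y 4 - x 6 * y 7 + x 7 * y 6,
    x 0 * y 2 - x 1 * y 3 + x 2 * y 0 + x 3 * y 1 + x 4 * y 6 + x 5 * y 7 - x 6 * y 4 - x 7 * y 5,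
    x 0 * y 3 + x 1 * y 2 - x 2 * y 1 + x 3 * y 0 + x 4 * y 7 - x 5 * y 6 + x 6 * y 5 - x 7 * y 4,
    x 0 * y 4 - x 1 * y 5 - x 2 * y 6 - x 3 * y 7 + x 4 * y 0 + x 5 * y 1 + x 6 * y 2 + x 7 * y 3,
    x 0 * y 5 + x 1 * y 4 - x 2 * y 7 + x 3 * y 6 - x 4 * y 1 + x 5 * y 0 - x 6 * y 3 + x 7 * y 2,
    x 0 * y 6 + x 1 * y 7 + x 2 * y 4 - x 3 * y 5 - x 4 * y 2 + x 5 * y 3 + x 6 * y 0 - x 7 * y 1,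
    x 0 * y 7 - x 1 * y 6 + x 2 * y 5 + x 3 * y 4 - x 4 * y 3 - x 5 * y 2 + x 6 * y 1 + x 7 * y 0
]

noncomputable instance instOne : One Octonion where
  one := EuclideanSpace.single 0 1

/-- The standard basis `e 0 = 1, e 1, …, e 7`. -/
noncomputable def e (i : Fin 8) : Octonion := EuclideanSpace.single i 1

/-- Octonionic conjugation. -/
noncomputable def conj (x : Octonion) : Octonion :=
  !₂[x 0, -x 1, -x 2, -x 3, -x 4, -x 5, -x 6, -x 7]

/-- The embedding of the reals. -/
noncomputable def ofReal (r : ℝ) : Octonion := EuclideanSpace.single 0 r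

end Octonion

/-- A (unital) `𝕆`-bimodule: a real vector space with real-bilinear left and right multiplications by
octonions, whose left, middle and right associators satisfy
`[p,q,x] = [q,x,p] = [x,p,q] = -[q,p,x]`. -/
class OctBimodule (M : Type*) [AddCommGroup M] [Module ℝ M] where
  /-- `lmul p x` is `p x`. -/
  lmul : Octonion →ₗ[ℝ] M →ₗ[ℝ] M
  /-- `rmul x p` is `x p`. -/
  rmul : M →ₗ[ℝ] Octonion →ₗ[ℝ] M
  one_lmul : ∀ x : M, lmul 1 x = x
  rmul_one : ∀ x : M, rmul x 1 = x
  left_assoc_eq_mid : ∀ (p q : Octonion) (x : M),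
    lmul (p * q) x - lmul p (lmul q x) = rmul (lmul q x) p - lmul q (rmul x p)
  mid_assoc_eq_right : ∀ (p q : Octonion) (x : M),
    rmul (lmul q x) p - lmul q (rmul x p) = rmul (rmul x p) q - rmul x (p * q)
  right_assoc_eq_neg_left : ∀ (p q : Octonion) (x : M),
    rmul (rmul x p) q - rmul x (p * q) = -(lmul (q * p) x - lmul q (lmul p x))

open OctBimodule (lmul rmul)

/-- `Re M`: the elements `m` with `[p,q,m] = 0` for all octonions `p`, `q`. -/
def octReal (M : Type*) [AddCommGroup M] [Module ℝ M] [OctBimodule M] : Set M :=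
  {m | ∀ p q : Octonion, lmul (p * q) m - lmul p (lmul q m) = 0}

/-- The real part operator `Re m = (5/12) m - (1/12) ∑_{i=1}^7 e_i m e_i` of an `𝕆`-bimodule, the
projection onto `octReal M`. -/
noncomputable def octRe {M : Type*} [AddCommGroup M] [Module ℝ M] [OctBimodule M] (m : M) : M :=
  (5 / 12 : ℝ) • m -
    (1 / 12 : ℝ) • ∑ i : Fin 7, rmul (lmul (Octonion.e i.succ) m) (Octonion.e i.succ)

/-- The second right associator `B_p(g,x) = g(x) p - g(x p)` of a map `g`. -/
def secondAssoc {M : Type*} [AddCommGroup M] [Module ℝ M] [OctBimodule M]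
    (p : Octonion) (g : M → M) (x : M) : M :=
  rmul (g x) p - g (rmul x p)

/-- Right multiplication of an operator by an octonion: `(g ⊙ p)(x) = g(p x) - B_p(g,x)`. -/
def opRightSmul {M : Type*} [AddCommGroup M] [Module ℝ M] [OctBimodule M]
    (g : M → M) (p : Octonion) (x : M) : M :=
  g (lmul p x) - secondAssoc p g x

/-- A Hilbert `𝕆`-bimodule (once `H` is complete): an `𝕆`-bimodule with a real-bilinear `𝕆`-valued
inner product `⟨·,·⟩` that is right para-linear in its second argument, `𝕆`-Hermitian, and
positive definite with `⟨u,u⟩ = ‖u‖²`. By polarization the real inner product of `H` is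
`Re ⟨·,·⟩`. -/
class OctHilbertBimodule (H : Type*) [NormedAddCommGroup H] [InnerProductSpace ℝ H] extends
    OctBimodule H where
  /-- `oinner u v` is the octonion `⟨u,v⟩`. -/
  oinner : H →ₗ[ℝ] H →ₗ[ℝ] Octonion
  oinner_para : ∀ (u x : H) (p : Octonion), (oinner u x * p - oinner u (rmul x p)) 0 = 0
  oinner_conj : ∀ u v : H, oinner u v = Octonion.conj (oinner v u)
  oinner_self : ∀ u : H, oinner u u = Octonion.ofReal (‖u‖ ^ 2)

open OctHilbertBimodule (oinner)

section

variable {H : Type*} [NormedAddCommGroup H] [InnerProductSpace ℝ H] [OctHilbertBimodule H]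

/-- A bounded real-linear operator `T` is right para-linear if `Re B_p(T,x) = 0` for all `p`, `x`. -/
def IsParaLinear (T : H →L[ℝ] H) : Prop :=
  ∀ (p : Octonion) (x : H), octRe (secondAssoc p T x) = 0

variable (H) in
/-- The slice cone `ℂ(H) = ⋃_J (Re H + J Re H)`, `J` running over the unit imaginary octonions. -/
def sliceCone : Set H :=
  {z | ∃ J : Octonion, J 0 = 0 ∧ ‖J‖ = 1 ∧ ∃ u ∈ octReal H, ∃ v ∈ octReal H, z = u + lmul J v}

/-- `z` is a strong eigenvector of `T` with strong eigenvalue `l`: a nonzero slice paravector with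
`T z = z l`. -/
def IsStrongEigenpair (T : H →L[ℝ] H) (z : H) (l : Octonion) : Prop :=
  z ∈ sliceCone H ∧ z ≠ 0 ∧ T z = rmul z l

/-- The domain of the functions in the calculus: the real strong eigenvalues of `T` together with `0`.
(Strong eigenvalues of a self-adjoint para-linear operator are real.) -/
def octSpectrum (T : H →L[ℝ] H) : Set ℝ :=
  {q | ∃ z : H, IsStrongEigenpair T z (Octonion.ofReal q)} ∪ {0}

open Classical in
/-- Weak associative orthonormal families: `⟨x_a,x_b⟩ = δ_ab` and
`B_p(x_a,x_b) = ⟨x_a,x_b⟩ p - ⟨x_a,x_b p⟩ = 0` for all `p`. -/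
def IsWeakAssocOrthonormal {I : Type*} (x : I → H) : Prop :=
  (∀ a b, oinner (x a) (x b) = if a = b then 1 else 0) ∧
    ∀ (p : Octonion) (a b : I), oinner (x a) (x b) * p - oinner (x a) (rmul (x b) p) = 0

/-- Weak associative orthonormal bases: the maximal weak associative orthonormal families. -/
def IsWeakAssocBasis {I : Type*} (x : I → H) : Prop :=
  IsWeakAssocOrthonormal x ∧
    ∀ S : Set H, Set.range x ⊆ S → IsWeakAssocOrthonormal (fun s : S => (s : H)) → S = Set.range x

/-- The slice projection `P_z(x) = z ⟨z,x⟩`. -/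
def sliceProj (z x : H) : H := rmul z (oinner z x)

/-- A spectral basis of `T`: a weak associative orthonormal basis `{z_i} ∪ {w_a}` of strong
eigenvectors, with `T z_i = z_i λ_i`, `λ_i` real and nonzero, and `T w_a = 0`. (The expansion
`T = ∑ λ_i P_{z_i}`, and for compact `T` countability of the `z_i` and `λ_i → 0`, are consequences and
are not required.) -/
structure SpectralBasis (T : H →L[ℝ] H) (N Λ : Type*) where
  z : N → H
  lam : N → ℝ
  w : Λ → H
  isBasis : IsWeakAssocBasis (Sum.elim z w)
  strong_z : ∀ i, IsStrongEigenpair T (z i) (Octonion.ofReal (lam i))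
  lam_ne_zero : ∀ i, lam i ≠ 0
  strong_w : ∀ a, IsStrongEigenpair T (w a) 0

namespace SpectralBasis

variable {T : H →L[ℝ] H} {N Λ : Type*} (B : SpectralBasis T N Λ)

/-- `λ_i` as a point of the spectrum. -/
def lamSpec (i : N) : octSpectrum T := ⟨B.lam i, Or.inl ⟨B.z i, B.strong_z i⟩⟩

/-- `P_0 = ∑_a P_{w_a}`. -/
noncomputable def projZero (x : H) : H := ∑' a, sliceProj (B.w a) x

/-- The right functional calculus
`Φ(f)(x) = (P_0 ⊙ f(0))(x) + ∑_i (P_{z_i} ⊙ f(λ_i))(x)` built from the spectral basis `B`. -/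
noncomputable def rightCalculus (f : octSpectrum T → Octonion) (x : H) : H :=
  opRightSmul B.projZero (f ⟨0, Or.inr rfl⟩) x +
    ∑' i, opRightSmul (sliceProj (B.z i)) (f (B.lamSpec i)) x

/-- The series defining `P_0` and `Φ(f)` converge (unconditionally, at every point), and `Φ(f)` is a
bounded right para-linear operator. -/
def CalculusWellDefined (f : octSpectrum T → Octonion) : Prop :=
  (∀ x, Summable fun a => sliceProj (B.w a) x) ∧
    (∀ x, Summable fun i => opRightSmul (sliceProj (B.z i)) (f (B.lamSpec i)) x) ∧
      ∃ F : H →L[ℝ] H, IsParaLinear F ∧ ∀ x, F x = B.rightCalculus f x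

end SpectralBasis

end

set_option linter.unusedSimpArgs false
set_option linter.unnecessarySeqFocus false

/-! ### Octonion arithmetic -/

namespace Octonion

/-! Left multiplications by e_1, …, e_7 make a bimodule a Clifford module, and the presence of right
multiplications excludes one of the two Clifford types. So every element is a sum of multiples p u
with u associative (`induction_real`), such u commute with 𝕆 (`rmul_real`), and para-linearity of g
amounts to g(u q) = g(u) q for u in Re M (`para_rmul_real`, `para_of_rmul_real`).

For a unit vector z the map q ↦ z q is isometric with adjoint ⟨z, ·⟩. Hence P_z is the orthogonal
projection onto z𝕆, and weak associative orthonormality makes the spaces x_a 𝕆 mutually orthogonal.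
Sums ∑ c_a P_{x_a} with bounded real c_a therefore converge to bounded operators, para-linear when
the x_a lie in the slice cone. Writing f = ∑ f_k e_k gives Φ(f) = ∑_k F_k ⊙ e_k with F_k = ∑_a
f_k(λ_a) P_{x_a}, which settles convergence, boundedness and para-linearity, and reduces uniqueness
to the F_k.

There, maximality gives ∑ P_{x_a} = id (`IsWeakAssocBasis.hasSum_sliceProj`). The delicate point is
that each x_a q, not only x_a, is an eigenvector of T (`IsWeakAssocBasis.map_rmul`): T need not
commute with right multiplication off Re H, and orthogonality to the rest of the basis supplies what
is missing. Self-adjointness then shows that F_k multiplies every λ-eigenvector of T by f_k(λ).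
Applied to the expansion of a vector in a second basis, this gives equality. -/

theorem ext_coord {x y : Octonion} (h0 : x 0 = y 0) (h1 : x 1 = y 1) (h2 : x 2 = y 2)
    (h3 : x 3 = y 3) (h4 : x 4 = y 4) (h5 : x 5 = y 5) (h6 : x 6 = y 6) (h7 : x 7 = y 7) :
    x = y := by
  ext i
  fin_cases i <;> assumption

section coordinates

variable (x y : Octonion)

theorem mul_apply_zero : (x * y) 0 = x 0 * y 0 - x 1 * y 1 - x 2 * y 2 - x 3 * y 3 - x 4 * y 4
    - x 5 * y 5 - x 6 * y 6 - x 7 * y 7 := rfl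
theorem mul_apply_one : (x * y) 1 = x 0 * y 1 + x 1 * y 0 + x 2 * y 3 - x 3 * y 2 + x 4 * y 5
    - x 5 * y 4 - x 6 * y 7 + x 7 * y 6 := rfl
theorem mul_apply_two : (x * y) 2 = x 0 * y 2 - x 1 * y 3 + x 2 * y 0 + x 3 * y 1 + x 4 * y 6
    + x 5 * y 7 - x 6 * y 4 - x 7 * y 5 := rfl
theorem mul_apply_three : (x * y) 3 = x 0 * y 3 + x 1 * y 2 - x 2 * y 1 + x 3 * y 0 + x 4 * y 7
    - x 5 * y 6 + x 6 * y 5 - x 7 * y 4 := rfl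
theorem mul_apply_four : (x * y) 4 = x 0 * y 4 - x 1 * y 5 - x 2 * y 6 - x 3 * y 7 + x 4 * y 0
    + x 5 * y 1 + x 6 * y 2 + x 7 * y 3 := rfl
theorem mul_apply_five : (x * y) 5 = x 0 * y 5 + x 1 * y 4 - x 2 * y 7 + x 3 * y 6 - x 4 * y 1
    + x 5 * y 0 - x 6 * y 3 + x 7 * y 2 := rfl
theorem mul_apply_six : (x * y) 6 = x 0 * y 6 + x 1 * y 7 + x 2 * y 4 - x 3 * y 5 - x 4 * y 2
    + x 5 * y 3 + x 6 * y 0 - x 7 * y 1 := rfl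
theorem mul_apply_seven : (x * y) 7 = x 0 * y 7 - x 1 * y 6 + x 2 * y 5 + x 3 * y 4 - x 4 * y 3
    - x 5 * y 2 + x 6 * y 1 + x 7 * y 0 := rfl

theorem one_apply (i : Fin 8) : (1 : Octonion) i = if i = 0 then 1 else 0 := by
  change (EuclideanSpace.single 0 1 : Octonion) i = _
  simp

theorem e_apply (i j : Fin 8) : e i j = if j = i then 1 else 0 := by
  simp [e]

theorem ofReal_apply (r : ℝ) (i : Fin 8) : ofReal r i = if i = 0 then r else 0 := by
  simp [ofReal]

theorem conj_apply_zero : conj x 0 = x 0 := rfl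
theorem conj_apply_one : conj x 1 = -x 1 := rfl
theorem conj_apply_two : conj x 2 = -x 2 := rfl
theorem conj_apply_three : conj x 3 = -x 3 := rfl
theorem conj_apply_four : conj x 4 = -x 4 := rfl
theorem conj_apply_five : conj x 5 = -x 5 := rfl
theorem conj_apply_six : conj x 6 = -x 6 := rfl
theorem conj_apply_seven : conj x 7 = -x 7 := rfl

end coordinates

attribute [local simp] mul_apply_zero mul_apply_one mul_apply_two mul_apply_three mul_apply_four
  mul_apply_five mul_apply_six mul_apply_seven one_apply e_apply ofReal_apply conj_apply_zero
  conj_apply_one conj_apply_two conj_apply_three conj_apply_four conj_apply_five conj_apply_six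
  conj_apply_seven

variable (x y z : Octonion)

theorem mul_one_oct : x * 1 = x := by apply ext_coord <;> simp
theorem one_mul_oct : 1 * x = x := by apply ext_coord <;> simp
theorem add_mul_oct : (x + y) * z = x * z + y * z := by apply ext_coord <;> simp <;> ring
theorem sub_mul_oct : (x - y) * z = x * z - y * z := by apply ext_coord <;> simp <;> ring
theorem mul_sub_oct : z * (x - y) = z * x - z * y := by apply ext_coord <;> simp <;> ring
theorem neg_mul_oct : (-x) * z = -(x * z) := by apply ext_coord <;> simp <;> ring
theorem smul_mul_oct (r : ℝ) : (r • x) * z = r • (x * z) := by apply ext_coord <;> simp <;> ring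
theorem mul_smul_oct (r : ℝ) : x * (r • z) = r • (x * z) := by apply ext_coord <;> simp <;> ring

theorem ofReal_eq_smul (r : ℝ) : ofReal r = r • (1 : Octonion) := by apply ext_coord <;> simp
theorem e_zero : e 0 = 1 := rfl

theorem conj_mul_oct : conj (x * y) = conj y * conj x := by apply ext_coord <;> simp <;> ring
theorem conj_conj_oct : conj (conj x) = x := by apply ext_coord <;> simp
theorem conj_one : conj 1 = 1 := by apply ext_coord <;> simp
theorem conj_eq_neg {x : Octonion} (h : x 0 = 0) : conj x = -x := by
  apply ext_coord <;> simp [h]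

theorem re_mul_comm : (x * y) 0 = (y * x) 0 := by simp; ring
theorem re_mul_assoc : ((x * y) * z) 0 = (x * (y * z)) 0 := by simp; ring

theorem inner_eq_re : inner ℝ x y = (y * conj x) 0 := by
  simp [PiLp.inner_apply, Fin.sum_univ_eight]

theorem inner_eq_re' : inner ℝ x y = (conj x * y) 0 := by
  rw [inner_eq_re, re_mul_comm]

theorem norm_sq_eq : ‖x‖ ^ 2 = x 0 ^ 2 + x 1 ^ 2 + x 2 ^ 2 + x 3 ^ 2 + x 4 ^ 2 + x 5 ^ 2 + x 6 ^ 2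
    + x 7 ^ 2 := by
  simp [EuclideanSpace.norm_sq_eq, Fin.sum_univ_eight]

theorem sum_smul_e : x = ∑ i, x i • e i := by
  apply ext_coord <;> simp [Fin.sum_univ_eight]

theorem mul_e_conj_re (i : Fin 8) : (x * conj (e i)) 0 = x i := by
  fin_cases i <;> simp

theorem mul_conj_cancel : (x * y) * conj y = ‖y‖ ^ 2 • x := by
  rw [norm_sq_eq]
  apply ext_coord <;> simp <;> ring

theorem conj_mul_cancel : conj y * (y * x) = ‖y‖ ^ 2 • x := by
  rw [norm_sq_eq]
  apply ext_coord <;> simp <;> ring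

theorem left_alternative : y * (y * x) = (y * y) * x := by
  apply ext_coord <;> simp <;> ring

theorem mul_self_unit {J : Octonion} (h0 : J 0 = 0) (h1 : ‖J‖ = 1) : J * J = -1 := by
  have h := conj_mul_cancel 1 J
  rw [mul_one_oct, conj_eq_neg h0, neg_mul_oct, h1] at h
  rw [← neg_neg (J * J), h]
  simp

theorem sum_e_mul_e :
    (5 / 12 : ℝ) • x - (1 / 12 : ℝ) • ∑ i : Fin 7, (e i.succ * x) * e i.succ = x 0 • (1 : Octonion) := by
  rw [Fin.sum_univ_seven]
  apply ext_coord <;> simp [Fin.succ] <;> ring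

theorem eq_zero_of_re_mul {x : Octonion} (h : ∀ p, (x * p) 0 = 0) : x = 0 := by
  ext i
  rw [← mul_e_conj_re x i, h]
  rfl

theorem inner_mul_mul : inner ℝ (x * y) (x * z) = ‖x‖ ^ 2 * inner ℝ y z := by
  rw [inner_eq_re', conj_mul_oct, re_mul_assoc, conj_mul_cancel, mul_smul_oct, inner_eq_re']
  rfl

/-- The nucleus of the octonions is the real line. -/
theorem eq_ofReal_of_assoc (h : ∀ p q, (p * x) * q = p * (x * q)) : x = ofReal (x 0) := by
  -- The associator of x with e_i and e_j detects the coordinates outside the quaternion subalgebra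
  -- of e_i, e_j. These three pairs together detect all imaginary coordinates.
  have h12 := h (e 1) (e 2)
  have h14 := h (e 1) (e 4)
  have h24 := h (e 2) (e 4)
  have a1 := fun i => congrArg (fun t : Octonion => t i) h12
  have a2 := fun i => congrArg (fun t : Octonion => t i) h14
  have a3 := fun i => congrArg (fun t : Octonion => t i) h24
  have b3 := a1 3
  have b4 := a1 4
  have b5 := a1 5
  have b6 := a1 6
  have b7 := a1 7
  have c2 := a2 2
  have c3 := a2 3
  have c6 := a2 6
  have c7 := a2 7
  have d1 := a3 1
  have d3 := a3 3
  have d5 := a3 5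
  have d7 := a3 7
  simp at b3 b4 b5 b6 b7 c2 c3 c6 c7 d1 d3 d5 d7
  apply ext_coord <;> simp <;> linarith

/-- Two distinct complex slices of the octonions meet in the real line: `1`, `J`, `K`, `J K` are
linearly independent. -/
theorem slice_independent {J K : Octonion} (hJ0 : J 0 = 0) (hJ : ‖J‖ = 1) (hK0 : K 0 = 0)
    (hK : ‖K‖ = 1) (h1 : K ≠ J) (h2 : K ≠ -J) {a b c d : ℝ}
    (h : a • (1 : Octonion) + b • K + c • J + d • (J * K) = 0) :
    a = 0 ∧ b = 0 ∧ c = 0 ∧ d = 0 := by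
  set s : ℝ := inner ℝ J K with hs
  have hJJ : inner ℝ J J = (1 : ℝ) := by rw [real_inner_self_eq_norm_sq, hJ, one_pow]
  have hKK : inner ℝ K K = (1 : ℝ) := by rw [real_inner_self_eq_norm_sq, hK, one_pow]
  have hs1 : s ≠ 1 := by
    intro hs1
    exact h1 ((inner_eq_one_iff_of_norm_eq_one hJ hK).1 hs1).symm
  have hs2 : s ≠ -1 := by
    intro hs2
    have : inner ℝ J (-K) = (1 : ℝ) := by rw [inner_neg_right, ← hs, hs2, neg_neg]
    have := (inner_eq_one_iff_of_norm_eq_one (𝕜 := ℝ) hJ (by rwa [norm_neg])).1 this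
    exact h2 (by rw [this, neg_neg])
  have oneJ : inner ℝ J 1 = (0 : ℝ) := by rw [inner_eq_re]; simp [hJ0]
  have oneK : inner ℝ K 1 = (0 : ℝ) := by rw [inner_eq_re]; simp [hK0]
  have hJK : (J * K) 0 = -s := by
    rw [hs, inner_eq_re', conj_eq_neg hJ0, neg_mul_oct]; simp
  have o1 : inner ℝ (1 : Octonion) (J * K) = -s := by
    rw [inner_eq_re', conj_one, one_mul_oct, hJK]
  have oJ : inner ℝ J (J * K) = (0 : ℝ) := by
    rw [inner_eq_re', conj_mul_cancel]; simp [hK0]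
  have oK : inner ℝ K (J * K) = (0 : ℝ) := by
    rw [inner_eq_re, mul_conj_cancel]; simp [hJ0]
  have oJK : inner ℝ (J * K) (J * K) = (1 : ℝ) := by
    rw [inner_mul_mul, hKK, hJ]; simp
  have o11 : inner ℝ (1 : Octonion) 1 = (1 : ℝ) := by rw [inner_eq_re]; simp
  have k1 := congrArg (fun t => inner ℝ (1 : Octonion) t) h
  have kJ := congrArg (fun t => inner ℝ J t) h
  have kK := congrArg (fun t => inner ℝ K t) h
  have kJK := congrArg (fun t => inner ℝ (J * K) t) h
  simp only [inner_add_right, real_inner_smul_right, inner_zero_right, o1, oJ, oK, oJK, o11, oneJ,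
    oneK, hJJ, hKK, ← hs, real_inner_comm J K, real_inner_comm J (1 : Octonion),
    real_inner_comm K (1 : Octonion), real_inner_comm J (J * K), real_inner_comm K (J * K),
    real_inner_comm (1 : Octonion) (J * K)] at k1 kJ kK kJK
  -- The only off-diagonal Gram entries are ⟨J,K⟩ = s and ⟨1,JK⟩ = -s: two blocks of determinant 1 -
  -- s², nonzero by the equality case of Cauchy–Schwarz.
  have hb : b * (1 - s) * (1 + s) = 0 := by linear_combination kK - s * kJ
  have hd : d * (1 - s) * (1 + s) = 0 := by linear_combination kJK + s * k1
  have n1 : 1 - s ≠ 0 := fun h => hs1 (by linarith)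
  have n2 : 1 + s ≠ 0 := fun h => hs2 (by linarith)
  have hb0 : b = 0 := by simpa [n1, n2] using hb
  have hd0 : d = 0 := by simpa [n1, n2] using hd
  subst hb0 hd0
  refine ⟨by linarith, rfl, by linarith, rfl⟩

end Octonion

/-! ### Clifford relations for left multiplications -/

namespace Octonion

theorem e_mul_self {i : Fin 8} (hi : i ≠ 0) : e i * e i = -1 := by
  refine mul_self_unit ?_ ?_
  · rw [e_apply, if_neg hi.symm]
  · simp [e]

theorem e_mul_anticomm {i j : Fin 8} (hi : i ≠ 0) (hj : j ≠ 0) (hij : i ≠ j) :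
    e i * e j + e j * e i = 0 := by
  fin_cases i <;> fin_cases j <;> simp at hi hj hij <;>
    apply ext_coord <;> simp [mul_apply_zero, mul_apply_one, mul_apply_two, mul_apply_three,
      mul_apply_four, mul_apply_five, mul_apply_six, mul_apply_seven, e_apply]
end Octonion

namespace OctBimodule

open Octonion

variable {M : Type*} [AddCommGroup M] [Module ℝ M] [OctBimodule M]

/-- At p = q the associator identities make the left associator equal to its own negative. -/
theorem lmul_left_alternative (p : Octonion) (x : M) : lmul p (lmul p x) = lmul (p * p) x := by
  have h := (left_assoc_eq_mid p p x).trans ((mid_assoc_eq_right p p x).trans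
    (right_assoc_eq_neg_left p p x))
  have h2 : (2 : ℝ) • (lmul (p * p) x - lmul p (lmul p x)) = 0 := by
    rw [two_smul]; nth_rewrite 1 [h]; abel
  rw [smul_eq_zero] at h2
  exact (sub_eq_zero.1 (h2.resolve_left two_ne_zero)).symm

theorem lmul_assoc_skew (p q : Octonion) (x : M) :
    lmul (p * q) x - lmul p (lmul q x) = -(lmul (q * p) x - lmul q (lmul p x)) :=
  (left_assoc_eq_mid p q x).trans ((mid_assoc_eq_right p q x).trans
    (right_assoc_eq_neg_left p q x))

theorem lmul_lmul_add (p q : Octonion) (x : M) :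
    lmul p (lmul q x) + lmul q (lmul p x) = lmul (p * q + q * p) x := by
  have h := lmul_assoc_skew p q x
  rw [map_add, LinearMap.add_apply]
  rw [neg_sub, sub_eq_sub_iff_add_eq_add] at h
  rw [h, add_comm]

/-- The failure of right associativity is a left associator, so right products can be computed with
left words. -/
theorem rmul_rmul (p q : Octonion) (x : M) :
    rmul (rmul x p) q = rmul x (p * q) + (lmul (p * q) x - lmul p (lmul q x)) := by
  rw [left_assoc_eq_mid, mid_assoc_eq_right]; abel

theorem rmul_lmul (p q : Octonion) (x : M) :
    rmul (lmul q x) p = lmul q (rmul x p) + (lmul (p * q) x - lmul p (lmul q x)) := by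
  rw [left_assoc_eq_mid]; abel

theorem rmul_right_alternative (p : Octonion) (x : M) : rmul (rmul x p) p = rmul x (p * p) := by
  rw [rmul_rmul, lmul_left_alternative, sub_self, add_zero]

theorem lmul_e_e {i : Fin 8} (hi : i ≠ 0) (x : M) : lmul (e i) (lmul (e i) x) = -x := by
  rw [lmul_left_alternative, e_mul_self hi, map_neg, LinearMap.neg_apply, one_lmul]

theorem lmul_e_anticomm {i j : Fin 8} (hi : i ≠ 0) (hj : j ≠ 0) (hij : i ≠ j) (x : M) :
    lmul (e j) (lmul (e i) x) = -lmul (e i) (lmul (e j) x) := by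
  have h := lmul_lmul_add (e j) (e i) x
  rw [e_mul_anticomm hj hi hij.symm, map_zero, LinearMap.zero_apply] at h
  exact eq_neg_of_add_eq_zero_left h

theorem lmul_eq_sum (p : Octonion) (x : M) : lmul p x = ∑ i, p i • lmul (e i) x := by
  conv_lhs => rw [sum_smul_e p]
  simp [map_sum, LinearMap.sum_apply]

theorem mem_octReal_iff {x : M} :
    x ∈ octReal M ↔ ∀ p q : Octonion, lmul (p * q) x = lmul p (lmul q x) := by
  simp [octReal, sub_eq_zero]

/-- The seven lines of the Fano plane are generated by four of them: if `e_i (e_j (e_k x)) = -x` on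
these four, then `x` is associative. -/
theorem mem_octReal_of_lines {x : M} (h1 : lmul (e 1) (lmul (e 2) (lmul (e 3) x)) = -x)
    (h2 : lmul (e 1) (lmul (e 4) (lmul (e 5) x)) = -x)
    (h3 : lmul (e 2) (lmul (e 4) (lmul (e 6) x)) = -x)
    (h4 : lmul (e 1) (lmul (e 7) (lmul (e 6) x)) = -x) : x ∈ octReal M := by
  have sq : ∀ (i : Fin 8) (_ : i ≠ 0) (v : M), lmul (e i) (lmul (e i) v) = -v :=
    fun i hi v => lmul_e_e hi v
  have s1 := sq 1 (by decide)
  have s2 := sq 2 (by decide)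
  have s4 := sq 4 (by decide)
  have s7 := sq 7 (by decide)
  have anti : ∀ (i j : Fin 8) (_ : i ≠ 0) (_ : j ≠ 0) (_ : i ≠ j) (v : M),
    lmul (e j) (lmul (e i) v) = -lmul (e i) (lmul (e j) v) :=
    fun i j hi hj hij v => lmul_e_anticomm hi hj hij v
  have a12 := anti 1 2 (by decide) (by decide) (by decide)
  have a14 := anti 1 4 (by decide) (by decide) (by decide)
  have a13 := anti 1 3 (by decide) (by decide) (by decide)
  have a15 := anti 1 5 (by decide) (by decide) (by decide)
  have a16 := anti 1 6 (by decide) (by decide) (by decide)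
  have a17 := anti 1 7 (by decide) (by decide) (by decide)
  have a24 := anti 2 4 (by decide) (by decide) (by decide)
  have a23 := anti 2 3 (by decide) (by decide) (by decide)
  have a25 := anti 2 5 (by decide) (by decide) (by decide)
  have a26 := anti 2 6 (by decide) (by decide) (by decide)
  have a27 := anti 2 7 (by decide) (by decide) (by decide)
  have a43 := anti 4 3 (by decide) (by decide) (by decide)
  have a45 := anti 4 5 (by decide) (by decide) (by decide)
  have a46 := anti 4 6 (by decide) (by decide) (by decide)
  have a47 := anti 4 7 (by decide) (by decide) (by decide)
  -- On x the four lines turn e_3, e_5, e_6, e_7 into words in e_1, e_2, e_4. Anticommutation moves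
  -- these letters next to x, and associativity becomes a comparison of coefficients.
  have e3 : lmul (e 3) x = lmul (e 1) (lmul (e 2) x) := by
    have := congrArg (fun v => lmul (e 2) (lmul (e 1) v)) h1
    simp only [s1, s2, map_neg, neg_neg, a12] at this
    exact this
  have e5 : lmul (e 5) x = lmul (e 1) (lmul (e 4) x) := by
    have := congrArg (fun v => lmul (e 4) (lmul (e 1) v)) h2
    simp only [s1, s4, map_neg, neg_neg, a14] at this
    exact this
  have e6 : lmul (e 6) x = lmul (e 2) (lmul (e 4) x) := by
    have := congrArg (fun v => lmul (e 4) (lmul (e 2) v)) h3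
    simp only [s2, s4, map_neg, neg_neg, a24] at this
    exact this
  have e7 : lmul (e 7) x = -lmul (e 1) (lmul (e 2) (lmul (e 4) x)) := by
    have := congrArg (fun v => lmul (e 1) v) h4
    simp only [s1, e6, map_neg, neg_neg, neg_inj, a27, a47] at this
    have := congrArg (fun v => lmul (e 4) (lmul (e 2) v)) this
    simp only [s2, s4, map_neg, neg_neg, a24, a12, a14] at this
    rw [this]
  rw [mem_octReal_iff]
  intro p q
  simp only [lmul_eq_sum (p * q) x, lmul_eq_sum q x, map_sum, map_smul]
  simp only [lmul_eq_sum p, Fin.sum_univ_eight, e_zero, one_lmul, e3, e5, e6, e7, s1, s2, s4, map_neg,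
    neg_neg, a12, a14, a13, a15, a16, a17, a24, a23, a25, a26, a27, a43, a45, a46, a47]
  simp only [mul_apply_zero, mul_apply_one, mul_apply_two, mul_apply_three, mul_apply_four,
    mul_apply_five, mul_apply_six, mul_apply_seven]
  module

end OctBimodule

/-! ### Generation of a bimodule by its associative elements -/

namespace Octonion

attribute [local simp] mul_apply_zero mul_apply_one mul_apply_two mul_apply_three mul_apply_four
  mul_apply_five mul_apply_six mul_apply_seven e_apply

theorem e1_mul_e4 : e 1 * e 4 = e 5 := by apply ext_coord <;> simp
theorem e4_mul_e1 : e 4 * e 1 = -e 5 := by apply ext_coord <;> simp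
theorem e5_mul_e4 : e 5 * e 4 = -e 1 := by apply ext_coord <;> simp
theorem e4_mul_e5 : e 4 * e 5 = e 1 := by apply ext_coord <;> simp
theorem e4_mul_e3 : e 4 * e 3 = -e 7 := by apply ext_coord <;> simp
theorem e4_mul_e2 : e 4 * e 2 = -e 6 := by apply ext_coord <;> simp

end Octonion

namespace OctBimodule

open Octonion

variable {M : Type*} [AddCommGroup M] [Module ℝ M] [OctBimodule M]

/-- The other Clifford type of the left multiplications does not occur in a bimodule. -/
theorem eq_zero_of_conjugate_lines {x : M} (h1 : lmul (e 1) (lmul (e 2) (lmul (e 3) x)) = x)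
    (h2 : lmul (e 1) (lmul (e 4) (lmul (e 5) x)) = x)
    (h3 : lmul (e 2) (lmul (e 4) (lmul (e 6) x)) = x)
    (h4 : lmul (e 1) (lmul (e 7) (lmul (e 6) x)) = x) : x = 0 := by
  have sq : ∀ (i : Fin 8) (_ : i ≠ 0) (v : M), lmul (e i) (lmul (e i) v) = -v :=
    fun i hi v => lmul_e_e hi v
  have s1 := sq 1 (by decide)
  have s2 := sq 2 (by decide)
  have s4 := sq 4 (by decide)
  have s5 := sq 5 (by decide)
  have s7 := sq 7 (by decide)
  have anti : ∀ (i j : Fin 8) (_ : i ≠ 0) (_ : j ≠ 0) (_ : i ≠ j) (v : M),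
    lmul (e j) (lmul (e i) v) = -lmul (e i) (lmul (e j) v) :=
    fun i j hi hj hij v => lmul_e_anticomm hi hj hij v
  have a12 := anti 1 2 (by decide) (by decide) (by decide)
  have a14 := anti 1 4 (by decide) (by decide) (by decide)
  have a15 := anti 1 5 (by decide) (by decide) (by decide)
  have a24 := anti 2 4 (by decide) (by decide) (by decide)
  have a43 := anti 4 3 (by decide) (by decide) (by decide)
  have a25 := anti 2 5 (by decide) (by decide) (by decide)
  have a27 := anti 2 7 (by decide) (by decide) (by decide)
  have a45 := anti 4 5 (by decide) (by decide) (by decide)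
  have a47 := anti 4 7 (by decide) (by decide) (by decide)
  have e3 : lmul (e 3) x = -lmul (e 1) (lmul (e 2) x) := by
    have := congrArg (fun v => lmul (e 2) (lmul (e 1) v)) h1
    simp only [s1, s2, map_neg, neg_neg, a12] at this
    exact this
  have e5 : lmul (e 5) x = -lmul (e 1) (lmul (e 4) x) := by
    have := congrArg (fun v => lmul (e 4) (lmul (e 1) v)) h2
    simp only [s1, s4, map_neg, neg_neg, a14] at this
    exact this
  have e6 : lmul (e 6) x = -lmul (e 2) (lmul (e 4) x) := by
    have := congrArg (fun v => lmul (e 4) (lmul (e 2) v)) h3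
    simp only [s2, s4, map_neg, neg_neg, a24] at this
    exact this
  have e7 : lmul (e 7) x = -lmul (e 1) (lmul (e 2) (lmul (e 4) x)) := by
    have := congrArg (fun v => lmul (e 1) v) h4
    simp only [s1, e6, map_neg, neg_neg, neg_inj, a27, a47] at this
    have := congrArg (fun v => lmul (e 4) (lmul (e 2) v)) this
    simp only [s2, s4, map_neg, neg_neg, a24, a12, a14] at this
    rw [this]
  have r1 : rmul (rmul x (e 1)) (e 4) = rmul x (e 5) + (2 : ℝ) • lmul (e 5) x := by
    rw [rmul_rmul, e1_mul_e4, e5]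
    module
  have r5 : rmul (rmul x (e 5)) (e 4) = -rmul x (e 1) - (2 : ℝ) • lmul (e 1) x := by
    rw [rmul_rmul, e5_mul_e4]
    simp only [map_neg, LinearMap.neg_apply, a15, a14, a45, e5, s1, s4, neg_neg]
    module
  have l5 : rmul (lmul (e 5) x) (e 4) = lmul (e 5) (rmul x (e 4)) + (2 : ℝ) • lmul (e 1) x := by
    rw [rmul_lmul, e4_mul_e5]
    simp only [e5, a14, map_neg, neg_neg, s4]
    module
  -- Right alternativity gives ((x e_1) e_4) e_4 = -x e_1; expanding the left side by `r1`, `r5`,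
  -- `l5` leaves e_5 (x e_4) = -e_1 x.
  have r4 : rmul x (e 4) = -lmul (e 4) x := by
    have h := rmul_right_alternative (e 4) (rmul x (e 1))
    rw [r1, map_add, map_smul, LinearMap.add_apply, LinearMap.smul_apply, r5, l5,
      e_mul_self (by decide), map_neg, rmul_one] at h
    have h5 : lmul (e 5) (rmul x (e 4)) = -lmul (e 1) x := by
      have : (2 : ℝ) • (lmul (e 5) (rmul x (e 4)) + lmul (e 1) x) = 0 := by
        rw [← sub_eq_zero] at h
        rw [← h]
        module
      exact eq_neg_of_add_eq_zero_left ((smul_eq_zero.1 this).resolve_left two_ne_zero)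
    have h6 := congrArg (fun v => lmul (e 5) v) h5
    simp only [s5, map_neg, a15, neg_neg, e5, s1, neg_inj] at h6
    rw [← h6, neg_neg]
  have l3 : rmul (lmul (e 3) x) (e 4) = lmul (e 1) (lmul (e 2) (lmul (e 4) x)) := by
    rw [rmul_lmul, e4_mul_e3, r4]
    simp only [map_neg, LinearMap.neg_apply, a43, e3, e7, a14, a24, neg_neg]
    module
  have l2 : rmul (lmul (e 2) x) (e 4) = lmul (e 2) (lmul (e 4) x) := by
    rw [rmul_lmul, e4_mul_e2, r4]
    simp only [map_neg, LinearMap.neg_apply, a24, e6, neg_neg]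
    module
  have l12 : rmul (lmul (e 1) (lmul (e 2) x)) (e 4) = lmul (e 1) (lmul (e 2) (lmul (e 4) x)) := by
    rw [rmul_lmul, e4_mul_e1, l2]
    simp only [map_neg, LinearMap.neg_apply, a24, a25, a14, e5, neg_neg, a12]
    module
  -- The equal vectors e_3 x and -e_1 (e_2 x) are sent by right multiplication by e_4 to opposite
  -- vectors.
  have h0 : (2 : ℝ) • lmul (e 1) (lmul (e 2) (lmul (e 4) x)) = 0 := by
    have : rmul (lmul (e 3) x) (e 4) = -rmul (lmul (e 1) (lmul (e 2) x)) (e 4) := by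
      rw [e3, map_neg, LinearMap.neg_apply]
    rw [l3, l12] at this
    rw [two_smul]
    nth_rewrite 1 [this]
    abel
  have h1 := (smul_eq_zero.1 h0).resolve_left two_ne_zero
  have h2 := congrArg (fun v => lmul (e 4) (lmul (e 2) (lmul (e 1) v))) h1
  simpa only [s1, s2, s4, map_neg, neg_neg, map_zero, neg_eq_zero] using h2

theorem lmul_real {u : M} (hu : u ∈ octReal M) (p q : Octonion) :
    lmul p (lmul q u) = lmul (p * q) u := (mem_octReal_iff.1 hu p q).symm

variable (M) in
/-- The elements associating with the octonions, as a subspace. -/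
def octRealSubmodule : Submodule ℝ M where
  carrier := octReal M
  zero_mem' := by simp [octReal]
  add_mem' := by
    intro a b ha hb
    rw [mem_octReal_iff] at *
    intro p q
    simp [ha p q, hb p q]
  smul_mem' := by
    intro c a ha
    rw [mem_octReal_iff] at *
    intro p q
    simp [ha p q]

variable (M) in
/-- The subspace generated by the multiples of associative elements. -/
def octRealSpan : Submodule ℝ M :=
  Submodule.span ℝ {x | ∃ (p : Octonion) (u : M), u ∈ octReal M ∧ x = lmul p u}

theorem lmul_mem_octRealSpan (q : Octonion) {x : M} (hx : x ∈ octRealSpan M) :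
    lmul q x ∈ octRealSpan M := by
  induction hx using Submodule.span_induction with
  | mem x h =>
    obtain ⟨p, u, hu, rfl⟩ := h
    exact Submodule.subset_span ⟨q * p, u, hu, lmul_real hu q p⟩
  | zero => simp
  | add x y _ _ hx hy => rw [map_add]; exact add_mem hx hy
  | smul c x _ hx => rw [map_smul]; exact Submodule.smul_mem _ c hx

theorem mem_octRealSpan_of_lmul {i : Fin 8} (hi : i ≠ 0) {x : M}
    (hx : lmul (e i) x ∈ octRealSpan M) : x ∈ octRealSpan M := by
  have := lmul_mem_octRealSpan (e i) hx
  rwa [lmul_e_e hi, neg_mem_iff] at this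

/-- Splitting along an involution commuting with the involutions of a list. -/
theorem mem_of_involution {E : Type*} [AddCommGroup E] [Module ℝ E] {S : Submodule ℝ E}
    (w : E →ₗ[ℝ] E) (hww : ∀ x, w (w x) = x) (l : List (E →ₗ[ℝ] E)) (hc : ∀ v ∈ l, ∀ x, v (w x) = w (v x))
    (hneg : ∀ y, w y = -y → (∀ v ∈ l, v y = -y) → y ∈ S)
    (hpos : ∀ y, w y = y → (∀ v ∈ l, v y = -y) → y ∈ S)
    (x : E) (hx : ∀ v ∈ l, v x = -x) : x ∈ S := by
  have h1 : x + w x ∈ S := by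
    refine hpos _ (by rw [map_add, hww, add_comm]) fun v hv => ?_
    rw [map_add, hc v hv, hx v hv, map_neg, neg_add]
  have h2 : x - w x ∈ S := by
    refine hneg _ (by rw [map_sub, hww, neg_sub]) fun v hv => ?_
    rw [map_sub, hc v hv, hx v hv, map_neg, neg_sub, sub_neg_eq_add, neg_add_eq_sub]
  have h3 : x = (1 / 2 : ℝ) • ((x + w x) + (x - w x)) := by module
  rw [h3]
  exact S.smul_mem _ (S.add_mem h1 h2)

theorem octRealSpan_eq_top : octRealSpan M = ⊤ := by
  have sq : ∀ (i : Fin 8) (_ : i ≠ 0) (v : M), lmul (e i) (lmul (e i) v) = -v :=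
    fun i hi v => lmul_e_e hi v
  have s1 := sq 1 (by decide)
  have s2 := sq 2 (by decide)
  have s3 := sq 3 (by decide)
  have s4 := sq 4 (by decide)
  have s5 := sq 5 (by decide)
  have s6 := sq 6 (by decide)
  have s7 := sq 7 (by decide)
  have anti : ∀ (i j : Fin 8) (_ : i ≠ 0) (_ : j ≠ 0) (_ : i ≠ j) (v : M),
    lmul (e j) (lmul (e i) v) = -lmul (e i) (lmul (e j) v) :=
    fun i j hi hj hij v => lmul_e_anticomm hi hj hij v
  have a12 := anti 1 2 (by decide) (by decide) (by decide)
  have a13 := anti 1 3 (by decide) (by decide) (by decide)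
  have a14 := anti 1 4 (by decide) (by decide) (by decide)
  have a15 := anti 1 5 (by decide) (by decide) (by decide)
  have a16 := anti 1 6 (by decide) (by decide) (by decide)
  have a17 := anti 1 7 (by decide) (by decide) (by decide)
  have a23 := anti 2 3 (by decide) (by decide) (by decide)
  have a24 := anti 2 4 (by decide) (by decide) (by decide)
  have a25 := anti 2 5 (by decide) (by decide) (by decide)
  have a26 := anti 2 6 (by decide) (by decide) (by decide)
  have a27 := anti 2 7 (by decide) (by decide) (by decide)
  have a34 := anti 3 4 (by decide) (by decide) (by decide)
  have a35 := anti 3 5 (by decide) (by decide) (by decide)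
  have a36 := anti 3 6 (by decide) (by decide) (by decide)
  have a37 := anti 3 7 (by decide) (by decide) (by decide)
  have a45 := anti 4 5 (by decide) (by decide) (by decide)
  have a46 := anti 4 6 (by decide) (by decide) (by decide)
  have a47 := anti 4 7 (by decide) (by decide) (by decide)
  have a56 := anti 5 6 (by decide) (by decide) (by decide)
  have a57 := anti 5 7 (by decide) (by decide) (by decide)
  have a67 := anti 6 7 (by decide) (by decide) (by decide)
  -- For a Fano line ijk this is an involution, and two of them commute because two lines share
  -- exactly one point. M is split into their joint eigenspaces.
  let W : Fin 8 → Fin 8 → Fin 8 → M →ₗ[ℝ] M := fun i j k => lmul (e i) ∘ₗ lmul (e j) ∘ₗ lmul (e k)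
  have hW : ∀ i j k x, W i j k x = lmul (e i) (lmul (e j) (lmul (e k) x)) := fun _ _ _ _ => rfl
  -- Left multiplication by e_i commutes with the lines through i and anticommutes with the others,
  -- so it exchanges the eigenspaces of a line missing i. Below, 1 is on 123 and 145 but off 246; 2
  -- is on 123 but off 145; 4 is off 123.
  have flip : ∀ (i : Fin 8) (_ : i ≠ 0) (l : List (M →ₗ[ℝ] M)) (w : M →ₗ[ℝ] M)
      (_ : ∀ x, w (lmul (e i) x) = -lmul (e i) (w x))
      (_ : ∀ v ∈ l, ∀ x, v (lmul (e i) x) = lmul (e i) (v x))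
      (_ : ∀ y, w y = -y → (∀ v ∈ l, v y = -y) → y ∈ octRealSpan M) (y : M) (_ : w y = y)
      (_ : ∀ v ∈ l, v y = -y), y ∈ octRealSpan M := by
    intro i hi l w hw hl hneg y hwy hly
    refine mem_octRealSpan_of_lmul hi (hneg _ (by rw [hw, hwy]) fun v hv => ?_)
    rw [hl v hv, hly v hv, map_neg]
  have step4 : ∀ x : M, (∀ v ∈ [W 1 2 3, W 1 4 5, W 2 4 6], v x = -x) → x ∈ octRealSpan M := by
    refine mem_of_involution (W 1 7 6) (fun x => ?_) [W 1 2 3, W 1 4 5, W 2 4 6] ?_ ?_ ?_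
    · simp only [hW, s1, s2, s3, s4, s5, s6, s7, a12, a13, a14, a15, a16, a17, a23, a24, a25, a26, a27, a34, a35, a36, a37, a45, a46, a47, a56, a57, a67, map_neg, neg_neg]
    · simp only [List.forall_mem_cons, List.not_mem_nil, hW, s1, s2, s3, s4, s5, s6, s7, a12, a13, a14, a15, a16, a17, a23, a24, a25, a26, a27, a34, a35, a36, a37, a45, a46, a47, a56, a57, a67, map_neg, neg_neg]
      simp
    · intro y h4 h
      simp only [List.forall_mem_cons, hW] at h h4
      refine Submodule.subset_span ⟨1, y, mem_octReal_of_lines h.1 h.2.1 h.2.2.1 h4, ?_⟩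
      rw [one_lmul]
    · intro y h4 h
      simp only [List.forall_mem_cons, hW] at h h4
      obtain ⟨h1, h2, h3, -⟩ := h
      refine mem_octRealSpan_of_lmul (i := 7) (by decide) ?_
      -- Of the four lines only 176 contains 7, so e_7 y has eigenvalue +1 on all four: the excluded
      -- type.
      have : lmul (e 7) y = 0 := by
        apply eq_zero_of_conjugate_lines
        · rw [← neg_inj, ← map_neg (lmul (e 7)), ← h1]
          simp only [s1, s2, s3, s4, s5, s6, s7, a12, a13, a14, a15, a16, a17, a23, a24, a25, a26, a27, a34, a35, a36, a37, a45, a46, a47, a56, a57, a67, map_neg, neg_neg]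
        · rw [← neg_inj, ← map_neg (lmul (e 7)), ← h2]
          simp only [s1, s2, s3, s4, s5, s6, s7, a12, a13, a14, a15, a16, a17, a23, a24, a25, a26, a27, a34, a35, a36, a37, a45, a46, a47, a56, a57, a67, map_neg, neg_neg]
        · rw [← neg_inj, ← map_neg (lmul (e 7)), ← h3]
          simp only [s1, s2, s3, s4, s5, s6, s7, a12, a13, a14, a15, a16, a17, a23, a24, a25, a26, a27, a34, a35, a36, a37, a45, a46, a47, a56, a57, a67, map_neg, neg_neg]
        · nth_rewrite 2 [← h4]
          simp only [s1, s2, s3, s4, s5, s6, s7, a12, a13, a14, a15, a16, a17, a23, a24, a25, a26, a27, a34, a35, a36, a37, a45, a46, a47, a56, a57, a67, map_neg, neg_neg]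
      rw [this]
      exact zero_mem _
  have step3 : ∀ x : M, (∀ v ∈ [W 1 2 3, W 1 4 5], v x = -x) → x ∈ octRealSpan M := by
    have hneg : ∀ y, W 2 4 6 y = -y → (∀ v ∈ [W 1 2 3, W 1 4 5], v y = -y) →
        y ∈ octRealSpan M := by
      intro y h3 h
      refine step4 y ?_
      simp only [List.forall_mem_cons] at h ⊢
      exact ⟨h.1, h.2.1, h3, by simp⟩
    refine mem_of_involution (W 2 4 6) (fun x => ?_) [W 1 2 3, W 1 4 5] ?_ hneg
      (flip 1 (by decide) _ _ ?_ ?_ hneg)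
    · simp only [hW, s1, s2, s3, s4, s5, s6, s7, a12, a13, a14, a15, a16, a17, a23, a24, a25, a26, a27, a34, a35, a36, a37, a45, a46, a47, a56, a57, a67, map_neg, neg_neg]
    · simp only [List.forall_mem_cons, List.not_mem_nil, hW, s1, s2, s3, s4, s5, s6, s7, a12, a13, a14, a15, a16, a17, a23, a24, a25, a26, a27, a34, a35, a36, a37, a45, a46, a47, a56, a57, a67, map_neg, neg_neg]
      simp
    · simp only [hW, s1, s2, s3, s4, s5, s6, s7, a12, a13, a14, a15, a16, a17, a23, a24, a25, a26, a27, a34, a35, a36, a37, a45, a46, a47, a56, a57, a67, map_neg, neg_neg, implies_true]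
    · simp only [List.forall_mem_cons, List.not_mem_nil, hW, s1, s2, s3, s4, s5, s6, s7, a12, a13, a14, a15, a16, a17, a23, a24, a25, a26, a27, a34, a35, a36, a37, a45, a46, a47, a56, a57, a67, map_neg, neg_neg]
      simp
  have step2 : ∀ x : M, (∀ v ∈ [W 1 2 3], v x = -x) → x ∈ octRealSpan M := by
    have hneg : ∀ y, W 1 4 5 y = -y → (∀ v ∈ [W 1 2 3], v y = -y) → y ∈ octRealSpan M := by
      intro y h2 h
      refine step3 y ?_
      simp only [List.forall_mem_cons] at h ⊢
      exact ⟨h.1, h2, by simp⟩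
    refine mem_of_involution (W 1 4 5) (fun x => ?_) [W 1 2 3] ?_ hneg
      (flip 2 (by decide) _ _ ?_ ?_ hneg)
    · simp only [hW, s1, s2, s3, s4, s5, s6, s7, a12, a13, a14, a15, a16, a17, a23, a24, a25, a26, a27, a34, a35, a36, a37, a45, a46, a47, a56, a57, a67, map_neg, neg_neg]
    · simp only [List.forall_mem_cons, List.not_mem_nil, hW, s1, s2, s3, s4, s5, s6, s7, a12, a13, a14, a15, a16, a17, a23, a24, a25, a26, a27, a34, a35, a36, a37, a45, a46, a47, a56, a57, a67, map_neg, neg_neg]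
      simp
    · simp only [hW, s1, s2, s3, s4, s5, s6, s7, a12, a13, a14, a15, a16, a17, a23, a24, a25, a26, a27, a34, a35, a36, a37, a45, a46, a47, a56, a57, a67, map_neg, neg_neg, implies_true]
    · simp only [List.forall_mem_cons, List.not_mem_nil, hW, s1, s2, s3, s4, s5, s6, s7, a12, a13, a14, a15, a16, a17, a23, a24, a25, a26, a27, a34, a35, a36, a37, a45, a46, a47, a56, a57, a67, map_neg, neg_neg]
      simp
  have hneg : ∀ y, W 1 2 3 y = -y → (∀ v ∈ ([] : List (M →ₗ[ℝ] M)), v y = -y) →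
      y ∈ octRealSpan M := fun y h1 _ => step2 y (by simpa using h1)
  refine eq_top_iff.2 fun x _ => mem_of_involution (W 1 2 3) (fun x => ?_) [] (by simp) hneg
      (flip 4 (by decide) _ _ ?_ (by simp) hneg) x (by simp)
  · simp only [hW, s1, s2, s3, s4, s5, s6, s7, a12, a13, a14, a15, a16, a17, a23, a24, a25, a26, a27, a34, a35, a36, a37, a45, a46, a47, a56, a57, a67, map_neg, neg_neg]
  · simp only [hW, s1, s2, s3, s4, s5, s6, s7, a12, a13, a14, a15, a16, a17, a23, a24, a25, a26, a27, a34, a35, a36, a37, a45, a46, a47, a56, a57, a67, map_neg, neg_neg, implies_true]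

/-- A bimodule is additively generated by the multiples of its associative elements. -/
theorem induction_real {P : M → Prop} (hmul : ∀ (p : Octonion) (u : M), u ∈ octReal M → P (lmul p u))
    (hadd : ∀ x y, P x → P y → P (x + y)) (x : M) : P x := by
  have hx : x ∈ octRealSpan M := octRealSpan_eq_top (M := M) ▸ Submodule.mem_top
  -- `P` is not assumed stable under scalars, so all real multiples are carried along.
  have key : ∀ c : ℝ, P (c • x) := by
    induction hx using Submodule.span_induction with
    | mem x h =>
      obtain ⟨p, u, hu, rfl⟩ := h
      intro c
      rw [← map_smul]
      exact hmul p _ ((octRealSubmodule M).smul_mem c hu)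
    | zero =>
      intro c
      simpa using hmul 0 0 (octRealSubmodule M).zero_mem
    | add x y _ _ hx hy => exact fun c => by rw [smul_add]; exact hadd _ _ (hx c) (hy c)
    | smul a x _ hx => exact fun c => by rw [smul_smul]; exact hx _
  simpa using key 1

end OctBimodule

/-! ### Commutation of associative elements, real parts and para-linear maps -/

namespace Octonion

theorem associator_spans (k : Fin 8) (hk : k ≠ 0) :
    ∃ p q r : Octonion, (2 : ℝ) • e k = (p * q) * r - p * (q * r) := by
  fin_cases k
  · exact absurd rfl hk
  · refine ⟨e 7, e 4, e 2, ?_⟩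
    apply ext_coord <;>
      simp [mul_apply_zero, mul_apply_one, mul_apply_two, mul_apply_three,
      mul_apply_four, mul_apply_five, mul_apply_six, mul_apply_seven, e_apply] <;>
      norm_num
  · refine ⟨e 1, e 4, e 7, ?_⟩
    apply ext_coord <;>
      simp [mul_apply_zero, mul_apply_one, mul_apply_two, mul_apply_three,
      mul_apply_four, mul_apply_five, mul_apply_six, mul_apply_seven, e_apply] <;>
      norm_num
  · refine ⟨e 2, e 4, e 5, ?_⟩
    apply ext_coord <;>
      simp [mul_apply_zero, mul_apply_one, mul_apply_two, mul_apply_three,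
      mul_apply_four, mul_apply_five, mul_apply_six, mul_apply_seven, e_apply] <;>
      norm_num
  · refine ⟨e 1, e 3, e 6, ?_⟩
    apply ext_coord <;>
      simp [mul_apply_zero, mul_apply_one, mul_apply_two, mul_apply_three,
      mul_apply_four, mul_apply_five, mul_apply_six, mul_apply_seven, e_apply] <;>
      norm_num
  · refine ⟨e 1, e 2, e 6, ?_⟩
    apply ext_coord <;>
      simp [mul_apply_zero, mul_apply_one, mul_apply_two, mul_apply_three,
      mul_apply_four, mul_apply_five, mul_apply_six, mul_apply_seven, e_apply] <;>
      norm_num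
  · refine ⟨e 2, e 3, e 7, ?_⟩
    apply ext_coord <;>
      simp [mul_apply_zero, mul_apply_one, mul_apply_two, mul_apply_three,
      mul_apply_four, mul_apply_five, mul_apply_six, mul_apply_seven, e_apply] <;>
      norm_num
  · refine ⟨e 1, e 2, e 4, ?_⟩
    apply ext_coord <;>
      simp [mul_apply_zero, mul_apply_one, mul_apply_two, mul_apply_three,
      mul_apply_four, mul_apply_five, mul_apply_six, mul_apply_seven, e_apply] <;>
      norm_num

end Octonion

namespace OctBimodule

open Octonion

variable {M : Type*} [AddCommGroup M] [Module ℝ M] [OctBimodule M]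

section real

variable {u : M} (hu : u ∈ octReal M) (p q : Octonion)
include hu

theorem rmul_lmul_real' : rmul (lmul q u) p = lmul q (rmul u p) := by
  rw [rmul_lmul, lmul_real hu, sub_self, add_zero]

theorem rmul_rmul_real : rmul (rmul u p) q = rmul u (p * q) := by
  rw [rmul_rmul, lmul_real hu, sub_self, add_zero]

/-- u[p,q,r] is the right associator of u p, and [p,q,r]u the left associator of r u. The bimodule
identities link them through the middle associator. As associators span the imaginary octonions, u
commutes with 𝕆. -/
theorem rmul_associator (r : Octonion) :
    rmul u ((p * q) * r - p * (q * r)) = lmul ((p * q) * r - p * (q * r)) u := by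
  have h1 : rmul (rmul (rmul u p) q) r - rmul (rmul u p) (q * r) =
      rmul u ((p * q) * r - p * (q * r)) := by
    rw [map_sub, rmul_rmul_real hu, rmul_rmul_real hu, rmul_rmul_real hu]
  have h2 : lmul (p * q) (lmul r u) - lmul p (lmul q (lmul r u)) =
      lmul ((p * q) * r - p * (q * r)) u := by
    rw [map_sub, LinearMap.sub_apply, lmul_real hu, lmul_real hu, lmul_real hu]
  have h3 : rmul (rmul (lmul r u) p) q - rmul (lmul r u) (p * q) =
      rmul (lmul r (rmul u p)) q - lmul r (rmul (rmul u p) q) := by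
    rw [rmul_lmul_real' hu, rmul_lmul_real' hu, ← rmul_rmul_real hu]
  rw [← h1, ← h2, left_assoc_eq_mid p q (lmul r u), mid_assoc_eq_right p q (lmul r u), h3,
    mid_assoc_eq_right q r (rmul u p)]

/-- Associative elements commute with the octonions. -/
theorem rmul_real : rmul u p = lmul p u := by
  have key : ∀ k : Fin 8, rmul u (e k) = lmul (e k) u := by
    intro k
    by_cases hk : k = 0
    · rw [hk, e_zero, rmul_one, one_lmul]
    · obtain ⟨a, b, c, h⟩ := associator_spans k hk
      have h' := rmul_associator hu a b c
      rw [← h, map_smul, map_smul, LinearMap.smul_apply] at h'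
      exact smul_right_injective M (two_ne_zero : (2 : ℝ) ≠ 0) h'
  rw [lmul_eq_sum]
  conv_lhs => rw [sum_smul_e p]
  simp [map_sum, key]

theorem rmul_lmul_real : rmul (lmul p u) q = lmul (p * q) u := by
  rw [rmul_lmul_real' hu, rmul_real hu, lmul_real hu]

theorem octRe_lmul_real : octRe (lmul p u) = p 0 • u := by
  have h : octRe (lmul p u) = lmul ((5 / 12 : ℝ) • p -
      (1 / 12 : ℝ) • ∑ i : Fin 7, (e i.succ * p) * e i.succ) u := by
    simp only [octRe, map_sub, map_smul, map_sum, LinearMap.sub_apply, LinearMap.smul_apply,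
      LinearMap.sum_apply, lmul_real hu, rmul_lmul_real hu]
  rw [h, sum_e_mul_e, map_smul, LinearMap.smul_apply, one_lmul]

theorem octRe_real : octRe u = u := by
  have := octRe_lmul_real hu 1
  simpa [one_lmul, one_apply] using this

end real

theorem octRe_add (x y : M) : octRe (x + y) = octRe x + octRe y := by
  simp only [octRe, map_add, LinearMap.add_apply, Finset.sum_add_distrib]
  module

theorem octRe_smul (c : ℝ) (x : M) : octRe (c • x) = c • octRe x := by
  simp only [octRe, map_smul, LinearMap.smul_apply, ← Finset.smul_sum]
  module

theorem octRe_sub (x y : M) : octRe (x - y) = octRe x - octRe y := by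
  rw [sub_eq_add_neg, octRe_add, ← neg_one_smul ℝ y, octRe_smul, neg_one_smul, ← sub_eq_add_neg]

theorem octRe_mem (x : M) : octRe x ∈ octReal M := by
  induction x using induction_real with
  | hmul p u hu => rw [octRe_lmul_real hu]; exact (octRealSubmodule M).smul_mem _ hu
  | hadd x y hx hy => rw [octRe_add]; exact (octRealSubmodule M).add_mem hx hy

/-- Octonionic coordinates: on p u with u associative, the i-th one is p_i u. -/
theorem eq_sum_octRe (x : M) : x = ∑ i, lmul (e i) (octRe (rmul x (conj (e i)))) := by
  induction x using induction_real with
  | hmul p u hu =>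
    simp only [rmul_lmul_real hu, octRe_lmul_real hu, mul_e_conj_re, map_smul]
    exact lmul_eq_sum p u
  | hadd x y hx hy =>
    simp only [map_add, LinearMap.add_apply, octRe_add, Finset.sum_add_distrib]
    rw [← hx, ← hy]

theorem eq_zero_of_octRe_rmul {x : M} (h : ∀ p, octRe (rmul x p) = 0) : x = 0 := by
  rw [eq_sum_octRe x]
  simp [h]

theorem octRe_rmul_rmul (x : M) (p q : Octonion) :
    octRe (rmul (rmul x p) q) = octRe (rmul x (p * q)) := by
  induction x using induction_real with
  | hmul r u hu =>
    rw [rmul_lmul_real hu, rmul_lmul_real hu, rmul_lmul_real hu, octRe_lmul_real hu,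
      octRe_lmul_real hu, re_mul_assoc]
  | hadd x y hx hy => simp only [map_add, LinearMap.add_apply, octRe_add, hx, hy]

/-- A para-linear map is determined by its values on associative elements. -/
theorem para_rmul_real {g : M →ₗ[ℝ] M} (hg : ∀ p x, octRe (secondAssoc p g x) = 0) {u : M}
    (hu : u ∈ octReal M) (q : Octonion) : g (rmul u q) = rmul (g u) q := by
  have hg' : ∀ p x, octRe (g (rmul x p)) = octRe (rmul (g x) p) := fun p x => by
    have := hg p x
    rw [secondAssoc, octRe_sub, sub_eq_zero] at this
    exact this.symm
  rw [← sub_eq_zero]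
  refine eq_zero_of_octRe_rmul fun p => ?_
  rw [map_sub, LinearMap.sub_apply, octRe_sub, sub_eq_zero, ← hg', rmul_rmul_real hu, hg',
    octRe_rmul_rmul]

theorem para_of_rmul_real {g : M →ₗ[ℝ] M}
    (hg : ∀ u ∈ octReal M, ∀ q, g (rmul u q) = rmul (g u) q) (p : Octonion) (x : M) :
    octRe (secondAssoc p g x) = 0 := by
  induction x using induction_real with
  | hmul q u hu =>
    rw [secondAssoc, ← rmul_real hu, hg u hu, rmul_rmul_real hu, hg u hu, octRe_sub,
      octRe_rmul_rmul, sub_self]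
  | hadd x y hx hy =>
    have : secondAssoc p g (x + y) = secondAssoc p g x + secondAssoc p g y := by
      simp only [secondAssoc, map_add, LinearMap.add_apply]
      abel
    rw [this, octRe_add, hx, hy, add_zero]

theorem rmul_rmul_add (p q : Octonion) (x : M) :
    rmul (rmul x p) q + rmul (rmul x q) p = rmul x (p * q) + rmul x (q * p) := by
  rw [rmul_rmul p q, rmul_rmul q p, lmul_assoc_skew p q]
  abel

theorem opRightSmul_rmul_real {g : M →ₗ[ℝ] M}
    (hg : ∀ u ∈ octReal M, ∀ q, g (rmul u q) = rmul (g u) q) {u : M} (hu : u ∈ octReal M)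
    (p q : Octonion) : opRightSmul g p (rmul u q) = rmul (opRightSmul g p u) q := by
  have h1 : opRightSmul g p u = rmul (g u) p := by
    rw [opRightSmul, secondAssoc, ← rmul_real hu, hg u hu, sub_self, sub_zero]
  have h2 : lmul p (rmul u q) = rmul u (p * q) := by
    rw [rmul_real hu, rmul_real hu, lmul_real hu]
  rw [h1, opRightSmul, secondAssoc, h2, hg u hu, hg u hu, rmul_rmul_real hu, hg u hu]
  -- What remains is the linearised right alternative law at g(u).
  rw [eq_sub_of_add_eq (rmul_rmul_add p q (g u))]
  abel

end OctBimodule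

/-! ### Adjoints and norms of multiplications -/

namespace OctHilbertBimodule

open Octonion OctBimodule

variable {H : Type*} [NormedAddCommGroup H] [InnerProductSpace ℝ H] [OctHilbertBimodule H]

theorem re_oinner (x y : H) : oinner x y 0 = inner ℝ x y := by
  have h := congrArg (fun t : Octonion => t 0) (oinner_self (x + y))
  have hx := congrArg (fun t : Octonion => t 0) (oinner_self x)
  have hy := congrArg (fun t : Octonion => t 0) (oinner_self y)
  have hc := congrArg (fun t : Octonion => t 0) (oinner_conj y x)
  simp only [map_add, LinearMap.add_apply, PiLp.add_apply, ofReal_apply, conj_apply_zero,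
    if_true] at h hx hy hc
  rw [hx, hy, hc, norm_add_sq_real] at h
  linarith

theorem inner_rmul_right (x y : H) (p : Octonion) :
    inner ℝ x (rmul y p) = (oinner x y * p) 0 := by
  have := oinner_para x y p
  rw [PiLp.sub_apply, sub_eq_zero] at this
  rw [this, re_oinner]

theorem inner_rmul_left (x y : H) (p : Octonion) :
    inner ℝ (rmul x p) y = inner ℝ x (rmul y (conj p)) := by
  rw [real_inner_comm, inner_rmul_right, inner_rmul_right, oinner_conj y x, ← conj_conj_oct p,
    ← conj_mul_oct, conj_apply_zero, conj_conj_oct, re_mul_comm]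

/-- `⟨x, ·⟩` is the adjoint of `q ↦ x q`. -/
theorem inner_oinner (q : Octonion) (x y : H) :
    inner ℝ q (oinner x y) = inner ℝ (rmul x q) y := by
  rw [inner_eq_re, inner_rmul_left, inner_rmul_right]

theorem rmul_conj_cancel (x : H) (p : Octonion) : rmul (rmul x p) (conj p) = ‖p‖ ^ 2 • x := by
  have h : conj p = (2 * p 0) • (1 : Octonion) - p := by
    apply ext_coord <;> simp [one_apply, conj_apply_zero, conj_apply_one, conj_apply_two,
      conj_apply_three, conj_apply_four, conj_apply_five, conj_apply_six, conj_apply_seven]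
    ring
  have h2 := mul_conj_cancel 1 p
  rw [one_mul_oct] at h2
  have h3 : rmul (rmul x p) (conj p) = rmul x (p * conj p) := by
    rw [h, map_sub, rmul_right_alternative, mul_sub_oct, map_sub, map_smul, mul_smul_oct,
      mul_one_oct, map_smul, rmul_one]
  rw [h3, h2, map_smul, rmul_one]

theorem norm_rmul (x : H) (p : Octonion) : ‖rmul x p‖ = ‖x‖ * ‖p‖ := by
  have h : ‖rmul x p‖ ^ 2 = (‖x‖ * ‖p‖) ^ 2 := by
    rw [← real_inner_self_eq_norm_sq, inner_rmul_left, rmul_conj_cancel, real_inner_smul_right,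
      real_inner_self_eq_norm_sq]
    ring
  exact (pow_left_inj₀ (norm_nonneg _) (by positivity) two_ne_zero).1 h

/-- Polarization of `norm_rmul`: q ↦ x q is ‖x‖ times an isometry, so following it by its adjoint
⟨x, ·⟩ gives ‖x‖². -/
theorem inner_rmul_rmul (x : H) (p q : Octonion) :
    inner ℝ (rmul x p) (rmul x q) = ‖x‖ ^ 2 * inner ℝ p q := by
  have h := norm_rmul x (p + q)
  have h2 : ‖rmul x p + rmul x q‖ ^ 2 = ‖x‖ ^ 2 * ‖p + q‖ ^ 2 := by
    rw [← map_add, h, mul_pow]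
  rw [norm_add_sq_real, norm_add_sq_real, norm_rmul, norm_rmul] at h2
  linarith

/-- Every element `x` satisfies `⟨x, x p⟩ = ⟨x, x⟩ p`. -/
theorem oinner_rmul_self (x : H) (p : Octonion) : oinner x (rmul x p) = ‖x‖ ^ 2 • p := by
  refine ext_inner_left ℝ fun q => ?_
  rw [inner_oinner, inner_rmul_rmul, real_inner_smul_right]

theorem oinner_rmul_real (x : H) {u : H} (hu : u ∈ octReal H) (q : Octonion) :
    oinner x (rmul u q) = oinner x u * q := by
  rw [← sub_eq_zero]
  refine eq_zero_of_re_mul fun p => ?_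
  rw [sub_mul_oct, PiLp.sub_apply, ← inner_rmul_right, rmul_rmul_real hu, inner_rmul_right,
    re_mul_assoc, sub_self]

/-- Octonions can be pulled out of u on the left and of v on the right in either order, so ⟨u,v⟩
lies in the nucleus of 𝕆, which is ℝ. -/
theorem oinner_real {u v : H} (hu : u ∈ octReal H) (hv : v ∈ octReal H) :
    oinner u v = (inner ℝ u v : ℝ) • (1 : Octonion) := by
  have key : ∀ p, oinner (rmul u p) v = conj p * oinner u v := fun p => by
    rw [oinner_conj, oinner_rmul_real _ hu, conj_mul_oct, ← oinner_conj]
  have h : oinner u v = ofReal (oinner u v 0) := by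
    refine eq_ofReal_of_assoc _ fun p q => ?_
    rw [← conj_conj_oct p, ← key, ← oinner_rmul_real _ hv, oinner_conj, oinner_rmul_real _ hu,
      conj_mul_oct, ← oinner_conj, oinner_rmul_real _ hv]
  rw [h, ofReal_eq_smul, re_oinner]

theorem oinner_rmul_rmul_real {u v : H} (hu : u ∈ octReal H) (hv : v ∈ octReal H)
    (p q : Octonion) : oinner (rmul u p) (rmul v q) = (inner ℝ u v : ℝ) • (conj p * q) := by
  rw [oinner_rmul_real _ hv, oinner_conj, oinner_rmul_real _ hu, conj_mul_oct, ← oinner_conj,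
    oinner_real hu hv, mul_smul_oct, smul_mul_oct, mul_one_oct]

theorem oinner_lmul_lmul_real {u v : H} (hu : u ∈ octReal H) (hv : v ∈ octReal H)
    (p q : Octonion) : oinner (lmul p u) (lmul q v) = (inner ℝ u v : ℝ) • (conj p * q) := by
  rw [← rmul_real hu, ← rmul_real hv, oinner_rmul_rmul_real hu hv]

theorem inner_lmul_left (x y : H) (p : Octonion) :
    inner ℝ (lmul p x) y = inner ℝ x (lmul (conj p) y) := by
  induction x using induction_real with
  | hmul r u hu =>
    induction y using induction_real with
    | hmul s v hv =>
      rw [lmul_real hu, lmul_real hv, ← re_oinner, ← re_oinner, oinner_lmul_lmul_real hu hv,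
        oinner_lmul_lmul_real hu hv, PiLp.smul_apply, PiLp.smul_apply, conj_mul_oct, re_mul_assoc]
    | hadd x y hx hy => simp only [map_add, inner_add_right, hx, hy]
  | hadd x y hx hy => simp only [map_add, inner_add_left, hx, hy]

theorem lmul_conj_cancel (x : H) (p : Octonion) : lmul (conj p) (lmul p x) = ‖p‖ ^ 2 • x := by
  induction x using induction_real with
  | hmul r u hu =>
    rw [lmul_real hu, lmul_real hu, conj_mul_cancel, map_smul, LinearMap.smul_apply]
  | hadd x y hx hy => simp only [map_add, smul_add, hx, hy]

theorem norm_lmul (x : H) (p : Octonion) : ‖lmul p x‖ = ‖p‖ * ‖x‖ := by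
  have h : ‖lmul p x‖ ^ 2 = (‖p‖ * ‖x‖) ^ 2 := by
    rw [← real_inner_self_eq_norm_sq, inner_lmul_left, lmul_conj_cancel, real_inner_smul_right,
      real_inner_self_eq_norm_sq]
    ring
  exact (pow_left_inj₀ (norm_nonneg _) (by positivity) two_ne_zero).1 h

/-- Left multiplication by an octonion, as a bounded operator. -/
noncomputable def lmulL (p : Octonion) : H →L[ℝ] H :=
  (lmul p : H →ₗ[ℝ] H).mkContinuous ‖p‖ fun x => (norm_lmul x p).le

/-- Right multiplication by an octonion, as a bounded operator. -/
noncomputable def rmulR (p : Octonion) : H →L[ℝ] H :=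
  ((rmul : H →ₗ[ℝ] Octonion →ₗ[ℝ] H).flip p).mkContinuous ‖p‖ fun x => by
    rw [mul_comm]; exact (norm_rmul x p).le

@[simp] theorem lmulL_apply (p : Octonion) (x : H) : lmulL p x = lmul p x := rfl
@[simp] theorem rmulR_apply (p : Octonion) (x : H) : rmulR p x = rmul x p := rfl

variable (H) in
/-- The real part operator, as a bounded operator. -/
noncomputable def octReL : H →L[ℝ] H :=
  (5 / 12 : ℝ) • ContinuousLinearMap.id ℝ H -
    (1 / 12 : ℝ) • ∑ i : Fin 7, rmulR (e i.succ) ∘L lmulL (e i.succ)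

theorem octReL_apply (x : H) : octReL H x = octRe x := by
  simp [octReL, octRe]

end OctHilbertBimodule

/-! ### Diagonal operators along orthogonal families -/

section diagonal

variable {ι E G : Type*} [NormedAddCommGroup E] [InnerProductSpace ℝ E] [NormedAddCommGroup G]
  [InnerProductSpace ℝ G] {V : ι → G →ₗᵢ[ℝ] E}

/-- Bessel's inequality: S = ∑ V_i P_i x satisfies ‖S‖² = ⟨S,x⟩ ≤ ‖S‖ ‖x‖. -/
theorem OrthogonalFamily.sum_norm_sq_le (hV : OrthogonalFamily ℝ (fun _ : ι => G) V)
    {P : ι → E →ₗ[ℝ] G} (hP : ∀ i q x, inner ℝ q (P i x) = inner ℝ (V i q) x) (s : Finset ι)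
    (x : E) : ∑ i ∈ s, ‖P i x‖ ^ 2 ≤ ‖x‖ ^ 2 := by
  have h1 := hV.norm_sum (fun i => P i x) s
  have h2 : inner ℝ (∑ i ∈ s, V i (P i x)) x = ∑ i ∈ s, ‖P i x‖ ^ 2 := by
    rw [sum_inner]
    refine Finset.sum_congr rfl fun i _ => ?_
    rw [← hP, real_inner_self_eq_norm_sq]
  have h3 := real_inner_le_norm (∑ i ∈ s, V i (P i x)) x
  rw [h2, ← h1] at h3
  rw [← h1]
  have h4 := norm_nonneg (∑ i ∈ s, V i (P i x))
  rcases h4.eq_or_lt with h0 | h0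
  · rw [← h0, zero_pow two_ne_zero]; positivity
  · have : ‖∑ i ∈ s, V i (P i x)‖ ≤ ‖x‖ := by nlinarith
    gcongr

/-- A bounded diagonal operator along an orthogonal family. -/
theorem OrthogonalFamily.exists_diagonal [CompleteSpace E]
    (hV : OrthogonalFamily ℝ (fun _ : ι => G) V) {P : ι → E →ₗ[ℝ] G}
    (hP : ∀ i q x, inner ℝ q (P i x) = inner ℝ (V i q) x) {c : ι → ℝ} {C : ℝ}
    (hc : ∀ i, |c i| ≤ C) :
    ∃ F : E →L[ℝ] E, ∀ x, HasSum (fun i => c i • V i (P i x)) (F x) := by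
  rcases isEmpty_or_nonempty ι with hι | ⟨⟨i₀⟩⟩
  · exact ⟨0, fun x => by simp⟩
  have hC : 0 ≤ C := (abs_nonneg _).trans (hc i₀)
  have bound : ∀ (s : Finset ι) (x : E), ∑ i ∈ s, ‖c i • P i x‖ ^ 2 ≤ (C * ‖x‖) ^ 2 := by
    intro s x
    calc ∑ i ∈ s, ‖c i • P i x‖ ^ 2 ≤ ∑ i ∈ s, C ^ 2 * ‖P i x‖ ^ 2 := by
          refine Finset.sum_le_sum fun i _ => ?_
          rw [norm_smul, mul_pow, Real.norm_eq_abs]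
          have := hc i
          gcongr
      _ = C ^ 2 * ∑ i ∈ s, ‖P i x‖ ^ 2 := by rw [Finset.mul_sum]
      _ ≤ C ^ 2 * ‖x‖ ^ 2 := by gcongr; exact hV.sum_norm_sq_le hP s x
      _ = (C * ‖x‖) ^ 2 := by ring
  have hs : ∀ x, Summable fun i => c i • V i (P i x) := fun x => by
    have h : Summable fun i => ‖c i • P i x‖ ^ 2 :=
      summable_of_sum_le (fun i => by positivity) fun s => bound s x
    have := (hV.summable_iff_norm_sq_summable fun i => c i • P i x).2 h
    simpa only [map_smul] using this
  let F : E →ₗ[ℝ] E :=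
    { toFun := fun x => ∑' i, c i • V i (P i x)
      map_add' := fun x y => by
        rw [← (hs x).tsum_add (hs y)]
        simp only [map_add, smul_add]
      map_smul' := fun r x => by
        rw [RingHom.id_apply, ← (hs x).tsum_const_smul]
        simp only [map_smul, smul_comm r] }
  refine ⟨F.mkContinuous C fun x => ?_, fun x => (hs x).hasSum⟩
  refine le_of_tendsto ((hs x).hasSum.norm) (Filter.Eventually.of_forall fun s => ?_)
  have h1 := hV.norm_sum (fun i => c i • P i x) s
  simp only [map_smul] at h1
  refine (pow_le_pow_iff_left₀ (norm_nonneg _) (by positivity) two_ne_zero).1 ?_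
  rw [h1]
  exact bound s x

end diagonal

theorem Octonion.zero_mul_oct (p : Octonion) : 0 * p = 0 := by
  simpa using Octonion.smul_mul_oct 0 p 0

/-! ### Weak associative orthonormal families -/

section orthonormal

open Octonion OctBimodule OctHilbertBimodule

variable {H : Type*} [NormedAddCommGroup H] [InnerProductSpace ℝ H] [OctHilbertBimodule H]
variable {I : Type*} {x : I → H}

theorem IsWeakAssocOrthonormal.norm_eq_one (hx : IsWeakAssocOrthonormal x) (a : I) :
    ‖x a‖ = 1 := by
  have h := congrArg (fun t : Octonion => t 0) (hx.1 a a)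
  simp only [if_true, oinner_self, ofReal_apply, one_apply] at h
  exact (pow_eq_one_iff_of_nonneg (norm_nonneg _) two_ne_zero).1 h

theorem IsWeakAssocOrthonormal.oinner_rmul_of_ne (hx : IsWeakAssocOrthonormal x) {a b : I}
    (hab : a ≠ b) (p : Octonion) : oinner (x a) (rmul (x b) p) = 0 := by
  have h := hx.2 p a b
  rw [hx.1, if_neg hab, sub_eq_zero, zero_mul_oct] at h
  exact h.symm

theorem IsWeakAssocOrthonormal.oinner_rmul_same (hx : IsWeakAssocOrthonormal x) (a : I)
    (p : Octonion) : oinner (x a) (rmul (x a) p) = p := by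
  rw [oinner_rmul_self, hx.norm_eq_one, one_pow, one_smul]

theorem IsWeakAssocOrthonormal.of_oinner_rmul (h1 : ∀ a p, oinner (x a) (rmul (x a) p) = p)
    (h2 : ∀ a b, a ≠ b → ∀ p, oinner (x a) (rmul (x b) p) = 0) : IsWeakAssocOrthonormal x := by
  have one : ∀ s t : H, oinner s t = oinner s (rmul t 1) := fun s t => by rw [rmul_one]
  refine ⟨fun a b => ?_, fun p a b => ?_⟩
  · split_ifs with hab
    · rw [hab, one, h1]
    · rw [one, h2 a b hab]
  · rw [sub_eq_zero, one (x a) (x b)]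
    by_cases hab : a = b
    · rw [hab, h1, h1, one_mul_oct]
    · rw [h2 a b hab, h2 a b hab, zero_mul_oct]

/-- The isometric embedding `q ↦ z q` for a unit vector `z`. -/
noncomputable def unitEmbedding (z : H) (hz : ‖z‖ = 1) : Octonion →ₗᵢ[ℝ] H where
  toLinearMap := rmul z
  norm_map' p := by
    change ‖rmul z p‖ = ‖p‖
    rw [norm_rmul, hz, one_mul]

theorem unitEmbedding_apply (z : H) (hz : ‖z‖ = 1) (p : Octonion) :
    unitEmbedding z hz p = rmul z p := rfl

theorem IsWeakAssocOrthonormal.orthogonalFamily (hx : IsWeakAssocOrthonormal x) :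
    OrthogonalFamily ℝ (fun _ : I => Octonion) fun a => unitEmbedding (x a) (hx.norm_eq_one a) := by
  intro a b hab p q
  rw [unitEmbedding_apply, unitEmbedding_apply, ← inner_oinner, hx.oinner_rmul_of_ne hab,
    inner_zero_right]

theorem IsWeakAssocOrthonormal.exists_diagonal [CompleteSpace H] (hx : IsWeakAssocOrthonormal x)
    {c : I → ℝ} {C : ℝ} (hc : ∀ a, |c a| ≤ C) :
    ∃ F : H →L[ℝ] H, ∀ y, HasSum (fun a => c a • sliceProj (x a) y) (F y) :=
  hx.orthogonalFamily.exists_diagonal (P := fun a => oinner (x a))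
    (fun a q y => inner_oinner q (x a) y) hc

/-- Otherwise the normalised y could be adjoined, against maximality. Orthogonality of y𝕆 to x_a 𝕆
is symmetric, so the one-sided hypothesis suffices. -/
theorem IsWeakAssocBasis.eq_zero (hx : IsWeakAssocBasis x) {y : H}
    (hy : ∀ a p, oinner (x a) (rmul y p) = 0) : y = 0 := by
  by_contra hy0
  obtain ⟨hx1, hx2⟩ := hx
  set w : H := ‖y‖⁻¹ • y with hw
  have hw1 : ‖w‖ = 1 := norm_smul_inv_norm hy0
  have hxw : ∀ a p, oinner (x a) (rmul w p) = 0 := fun a p => by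
    rw [hw, map_smul, LinearMap.smul_apply, map_smul, hy, smul_zero]
  have hwx : ∀ a p, oinner w (rmul (x a) p) = 0 := fun a p => by
    refine ext_inner_left ℝ fun q => ?_
    rw [inner_oinner, real_inner_comm, ← inner_oinner, hxw, inner_zero_right, inner_zero_right]
  have hww : ∀ p, oinner w (rmul w p) = p := fun p => by
    rw [oinner_rmul_self, hw1, one_pow, one_smul]
  have hx_ne : ∀ a, x a ≠ w := fun a h => by
    have h1 := hxw a 1
    rw [h, hww] at h1
    have := congrArg (fun t : Octonion => t 0) h1
    simp [one_apply] at this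
  have key := hx2 (Set.range x ∪ {w}) Set.subset_union_left ?_
  · obtain ⟨a, ha⟩ : w ∈ Set.range x := key ▸ Or.inr rfl
    exact hx_ne a ha
  · refine .of_oinner_rmul ?_ ?_
    · rintro ⟨s, ⟨a, rfl⟩ | rfl⟩ p
      · exact hx1.oinner_rmul_same a p
      · exact hww p
    · rintro ⟨s, ⟨a, rfl⟩ | rfl⟩ ⟨t, ⟨b, rfl⟩ | rfl⟩ hst p
      · exact hx1.oinner_rmul_of_ne (fun h => hst (by subst h; rfl)) p
      · exact hxw a p
      · exact hwx b p
      · exact absurd rfl hst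

end orthonormal

/-! ### Slice projections and completeness -/

namespace OctHilbertBimodule

open Octonion OctBimodule

variable {H : Type*} [NormedAddCommGroup H] [InnerProductSpace ℝ H] [OctHilbertBimodule H]

section slice

variable {J : Octonion} (hJ0 : J 0 = 0) {u v : H} (hu : u ∈ octReal H)
  (hv : v ∈ octReal H)
include hu hv

theorem oinner_slice_real {w : H} (hw : w ∈ octReal H) : oinner (u + lmul J v) w =
    (inner ℝ u w : ℝ) • (1 : Octonion) + (inner ℝ v w : ℝ) • conj J := by
  have h := oinner_lmul_lmul_real hv hw J 1
  rw [one_lmul, mul_one_oct] at h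
  rw [map_add, LinearMap.add_apply, oinner_real hu hw, h]

theorem rmul_rmul_slice (q : Octonion) :
    rmul (rmul (u + lmul J v) J) q = rmul (u + lmul J v) (J * q) := by
  simp only [map_add, LinearMap.add_apply]
  rw [rmul_rmul_real hu, rmul_lmul_real hv, rmul_lmul_real hv, rmul_lmul_real hv,
    left_alternative]

include hJ0 in
theorem rmul_slice_comm (a b : ℝ) (q : Octonion) :
    rmul (rmul (u + lmul J v) (a • (1 : Octonion) + b • conj J)) q =
      rmul (u + lmul J v) ((a • (1 : Octonion) + b • conj J) * q) := by
  rw [conj_eq_neg hJ0, add_mul_oct, smul_mul_oct, smul_mul_oct, one_mul_oct, neg_mul_oct]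
  simp only [map_add (rmul (u + lmul J v)), map_smul (rmul (u + lmul J v)),
    map_neg (rmul (u + lmul J v)), ← rmul_rmul_slice hu hv]
  simp only [map_add rmul, map_smul rmul, map_neg rmul, LinearMap.add_apply, LinearMap.smul_apply,
    LinearMap.neg_apply, rmul_one]

end slice

/-- ⟨z,w⟩ lies in ℝ + ℝJ for the slice of z, and for such octonions right multiplication of z
associates, because J(Jq) = (JJ)q. -/
theorem sliceProj_rmul_real {z : H} (hz : z ∈ sliceCone H) {w : H} (hw : w ∈ octReal H)
    (q : Octonion) : sliceProj z (rmul w q) = rmul (sliceProj z w) q := by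
  obtain ⟨J, hJ0, hJ, u, hu, v, hv, rfl⟩ := hz
  rw [sliceProj, sliceProj, oinner_rmul_real _ hw, oinner_slice_real hu hv hw,
    rmul_slice_comm hJ0 hu hv]

/-- The slice projection as a linear map. -/
noncomputable def sliceProjLinear (z : H) : H →ₗ[ℝ] H := rmul z ∘ₗ oinner z

end OctHilbertBimodule

section complete

open Octonion OctBimodule OctHilbertBimodule

variable {H : Type*} [NormedAddCommGroup H] [InnerProductSpace ℝ H] [OctHilbertBimodule H]
variable {I : Type*} {x : I → H}

theorem IsWeakAssocOrthonormal.oinner_hasSum (hx : IsWeakAssocOrthonormal x) {y s : H}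
    (h : HasSum (fun a => sliceProj (x a) y) s) (a : I) : oinner (x a) s = oinner (x a) y := by
  refine ext_inner_left ℝ fun q => ?_
  rw [inner_oinner, inner_oinner]
  have h1 := (innerSL ℝ (rmul (x a) q)).hasSum h
  have h2 : HasSum (fun b => innerSL ℝ (rmul (x a) q) (sliceProj (x b) y))
      (innerSL ℝ (rmul (x a) q) (sliceProj (x a) y)) := by
    refine hasSum_single a fun b hb => ?_
    rw [innerSL_apply_apply, ← inner_oinner, sliceProj, hx.oinner_rmul_of_ne hb.symm,
      inner_zero_right]
  have h3 := h1.unique h2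
  rw [innerSL_apply_apply, innerSL_apply_apply] at h3
  rw [h3, ← inner_oinner, sliceProj, hx.oinner_rmul_same, inner_oinner]

/-- A weak associative orthonormal basis in the slice cone is complete. -/
theorem IsWeakAssocBasis.hasSum_sliceProj [CompleteSpace H] (hx : IsWeakAssocBasis x)
    (hs : ∀ a, x a ∈ sliceCone H) (y : H) : HasSum (fun a => sliceProj (x a) y) y := by
  obtain ⟨F, hF⟩ := hx.1.exists_diagonal (c := fun _ => 1) (C := 1) (by simp)
  simp only [one_smul] at hF
  suffices h : F y = y by
    have := hF y
    rwa [h] at this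
  -- `IsWeakAssocBasis.eq_zero` needs all right multiples of F w - w, and F is known to pass through
  -- right multiplication only at associative w.
  induction y using induction_real with
  | hadd y z hy hz => rw [map_add, hy, hz]
  | hmul q w hw =>
    have hFw : ∀ p, F (rmul w p) = rmul (F w) p := fun p => by
      refine (hF (rmul w p)).unique ?_
      have := (rmulR p).hasSum (hF w)
      simp only [rmulR_apply, ← sliceProj_rmul_real (hs _) hw] at this
      exact this
    have h0 : F w - w = 0 := by
      refine hx.eq_zero fun a p => ?_
      rw [map_sub, LinearMap.sub_apply, ← hFw, map_sub, hx.1.oinner_hasSum (hF _), sub_self]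
    rw [← rmul_real hw, hFw, sub_eq_zero.1 h0]

end complete

/-! ### Eigenvectors of T and their right multiples -/

section eigen

open Octonion OctBimodule OctHilbertBimodule

variable {H : Type*} [NormedAddCommGroup H] [InnerProductSpace ℝ H] [OctHilbertBimodule H]

namespace OctHilbertBimodule

theorem _root_.IsParaLinear.rmul_real {T : H →L[ℝ] H} (hT : IsParaLinear T) {u : H}
    (hu : u ∈ octReal H) (q : Octonion) : T (rmul u q) = rmul (T u) q :=
  para_rmul_real (g := (T : H →ₗ[ℝ] H)) hT hu q

/-- The projection onto the slice `Re H + J Re H`. -/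
noncomputable def sliceMap (J : Octonion) : H →L[ℝ] H :=
  octReL H + lmulL J ∘L octReL H ∘L rmulR (conj J)

theorem sliceMap_apply (J : Octonion) (x : H) :
    sliceMap J x = octRe x + lmul J (octRe (rmul x (conj J))) := by
  simp [sliceMap, octReL_apply]

section slice

variable {J : Octonion} (hJ0 : J 0 = 0) (hJ : ‖J‖ = 1) {u v : H} (hu : u ∈ octReal H)
  (hv : v ∈ octReal H)
include hu hv hJ0 hJ

theorem sliceMap_slice : sliceMap J (u + lmul J v) = u + lmul J v := by
  have h := mul_conj_cancel 1 J
  rw [one_mul_oct, hJ, one_pow, one_smul] at h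
  rw [sliceMap_apply, octRe_add, octRe_real hu, octRe_lmul_real hv, hJ0, map_add,
    LinearMap.add_apply, octRe_add, OctBimodule.rmul_real hu, octRe_lmul_real hu,
    rmul_lmul_real hv, octRe_lmul_real hv, h, conj_apply_zero, hJ0]
  simp [one_apply]

theorem rmul_slice_unit : rmul (u + lmul J v) J = -v + lmul J u := by
  rw [map_add, LinearMap.add_apply, OctBimodule.rmul_real hu, rmul_lmul_real hv,
    mul_self_unit hJ0 hJ, map_neg, LinearMap.neg_apply, one_lmul, add_comm]

theorem sliceMap_rmul_slice (a b : ℝ) :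
    sliceMap J (rmul (u + lmul J v) (a • (1 : Octonion) + b • conj J)) =
      rmul (u + lmul J v) (a • (1 : Octonion) + b • conj J) := by
  have h := sliceMap_slice hJ0 hJ ((octRealSubmodule H).neg_mem hv) hu
  rw [← rmul_slice_unit hJ0 hJ hu hv] at h
  rw [map_add, map_smul, map_smul, rmul_one, conj_eq_neg hJ0, map_neg, map_add, map_smul, map_smul,
    map_neg, h, sliceMap_slice hJ0 hJ hu hv]

/-- Right multiplication by J merely replaces (u, v) by (-v, u), so para-linearity on Re H suffices.
-/
theorem _root_.IsParaLinear.rmul_unit_slice {T : H →L[ℝ] H} (hT : IsParaLinear T) :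
    T (rmul (u + lmul J v) J) = rmul (T (u + lmul J v)) J := by
  rw [rmul_slice_unit hJ0 hJ hu hv, map_add, map_add, ← OctBimodule.rmul_real hu,
    ← OctBimodule.rmul_real hv, hT.rmul_real hu, hT.rmul_real hv, map_add, LinearMap.add_apply,
    rmul_right_alternative, mul_self_unit hJ0 hJ, map_neg, map_neg, rmul_one, add_comm]

theorem _root_.IsParaLinear.rmul_slice {T : H →L[ℝ] H} (hT : IsParaLinear T) {r : ℝ}
    (hr : T (u + lmul J v) = r • (u + lmul J v)) (a b : ℝ) :
    T (rmul (u + lmul J v) (a • (1 : Octonion) + b • conj J)) =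
      r • rmul (u + lmul J v) (a • (1 : Octonion) + b • conj J) := by
  have h := hT.rmul_unit_slice hJ0 hJ hu hv
  rw [hr, map_smul, LinearMap.smul_apply] at h
  rw [map_add (rmul _), map_smul (rmul _), map_smul (rmul _), rmul_one, conj_eq_neg hJ0,
    map_neg (rmul _), map_add T, map_smul T, map_smul T, map_neg T, h, hr]
  module

end slice

theorem rmul_rmul_of_sliceMap_eq {J : Octonion} {x : H} (hx : sliceMap J x = x) (q : Octonion) :
    rmul (rmul x J) q = rmul x (J * q) := by
  rw [← hx, sliceMap_apply]
  exact rmul_rmul_slice (octRe_mem _) (octRe_mem _) q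

/-- Orthogonal elements of the slice cone either lie in a common slice or have orthogonal
components. -/
theorem slice_or_orthogonal {J : Octonion} (hJ0 : J 0 = 0) (hJ : ‖J‖ = 1) {u v z : H}
    (hu : u ∈ octReal H) (hv : v ∈ octReal H) (hz : z ∈ sliceCone H)
    (h : oinner z (u + lmul J v) = 0) :
    (∃ c ∈ octReal H, ∃ d ∈ octReal H, z = c + lmul J d) ∨ (oinner z u = 0 ∧ oinner z v = 0) := by
  obtain ⟨K, hK0, hK, c, hc, d, hd, rfl⟩ := hz
  by_cases h1 : K = J
  · exact Or.inl ⟨c, hc, d, hd, by rw [h1]⟩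
  by_cases h2 : K = -J
  · refine Or.inl ⟨c, hc, -d, (octRealSubmodule H).neg_mem hd, ?_⟩
    rw [h2, map_neg, map_neg, LinearMap.neg_apply]
  right
  rw [← OctBimodule.rmul_real hv, map_add, oinner_rmul_real _ hv, oinner_slice_real hc hd hu,
    oinner_slice_real hc hd hv, conj_eq_neg hK0, add_mul_oct, smul_mul_oct, smul_mul_oct,
    one_mul_oct, neg_mul_oct] at h
  -- With z = c + K d, the octonion ⟨z,u⟩ + ⟨z,v⟩J is a combination of 1, J, K, KJ whose
  -- coefficients are, up to sign, the inner products of c, d with u, v.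
  obtain ⟨a1, a2, a3, a4⟩ := slice_independent (J := K) (K := J) (a := inner ℝ c u) (b := inner ℝ c v)
    (c := -inner ℝ d u) (d := -inner ℝ d v) hK0 hK hJ0 hJ (fun h => h1 h.symm)
    (fun h => h2 (by rw [h, neg_neg])) (by rw [← h]; module)
  rw [neg_eq_zero] at a3 a4
  rw [oinner_slice_real hc hd hu, oinner_slice_real hc hd hv, a1, a2, a3, a4]
  simp

end OctHilbertBimodule

variable {I : Type*} {x : I → H}

/-- For a complete family of strong eigenvectors `z` with real eigenvalues, all `z q` are
eigenvectors too. -/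
theorem IsWeakAssocBasis.map_rmul [CompleteSpace H] (hx : IsWeakAssocBasis x)
    (hs : ∀ a, x a ∈ sliceCone H) {T : H →L[ℝ] H} (hT : IsParaLinear T) {r : I → ℝ}
    (hr : ∀ a, T (x a) = r a • x a) (a : I) (q : Octonion) :
    T (rmul (x a) q) = r a • rmul (x a) q := by
  -- T(x_a q) = T(u) q + T(v)(J q), whereas (T x_a) q = T(u) q + (T(v) J) q. They agree once T v
  -- lies in the slice of J.
  obtain ⟨J, hJ0, hJ, u, hu, v, hv, ha⟩ := hs a
  have key : ∀ b, (∃ c ∈ octReal H, ∃ d ∈ octReal H, x b = c + lmul J d) ∨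
      (oinner (x b) u = 0 ∧ oinner (x b) v = 0) := fun b => by
    by_cases hab : b = a
    · exact Or.inl ⟨u, hu, v, hv, by rw [hab, ha]⟩
    · refine slice_or_orthogonal hJ0 hJ hu hv (hs b) ?_
      rw [← ha, hx.1.1, if_neg hab]
  -- In the expansion of w, the terms from the slice of J stay there under T, and all others vanish.
  have fixed : ∀ w ∈ octReal H, (∀ b, (∃ c ∈ octReal H, ∃ d ∈ octReal H, x b = c + lmul J d) ∨
      oinner (x b) w = 0) → sliceMap J (T w) = T w := by
    intro w hw hb
    have h1 := T.hasSum (hx.hasSum_sliceProj hs w)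
    have h2 := (sliceMap J).hasSum h1
    refine h2.unique ?_
    convert h1 using 2 with b
    rcases hb b with ⟨c, hc, d, hd, h⟩ | h
    · have hrb := hr b
      rw [sliceProj, h, oinner_slice_real hc hd hw]
      rw [h] at hrb
      rw [IsParaLinear.rmul_slice hJ0 hJ hc hd hT hrb, map_smul,
        sliceMap_rmul_slice hJ0 hJ hc hd]
    · rw [sliceProj, h]
      simp
  have hTv := fixed v hv fun b => (key b).imp_right And.right
  have e1 : rmul (x a) q = rmul u q + rmul v (J * q) := by
    rw [ha, map_add, LinearMap.add_apply, rmul_lmul_real hv, OctBimodule.rmul_real hv (J * q)]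
  have e2 : T (x a) = T u + rmul (T v) J := by
    rw [ha, map_add, ← OctBimodule.rmul_real hv, IsParaLinear.rmul_real hT hv]
  rw [← LinearMap.smul_apply, ← map_smul, ← hr, e2, e1, map_add, IsParaLinear.rmul_real hT hu,
    IsParaLinear.rmul_real hT hv, map_add, LinearMap.add_apply, rmul_rmul_of_sliceMap_eq hTv]

end eigen

/-! ### The functional calculus and its independence of the basis -/

section calculus

open Octonion OctBimodule OctHilbertBimodule

variable {H : Type*} [NormedAddCommGroup H] [InnerProductSpace ℝ H] [OctHilbertBimodule H]

theorem IsParaLinear.of_rmul_real {T : H →L[ℝ] H}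
    (hT : ∀ u ∈ octReal H, ∀ q, T (rmul u q) = rmul (T u) q) : IsParaLinear T :=
  para_of_rmul_real (g := (T : H →ₗ[ℝ] H)) hT

namespace OctHilbertBimodule

/-- The operator `F ⊙ p` as a bounded operator. -/
noncomputable def opRightSmulL (F : H →L[ℝ] H) (p : Octonion) : H →L[ℝ] H :=
  F ∘L lmulL p - (rmulR p ∘L F - F ∘L rmulR p)

theorem opRightSmulL_apply (F : H →L[ℝ] H) (p : Octonion) (y : H) :
    opRightSmulL F p y = opRightSmul F p y := by
  simp [opRightSmulL, opRightSmul, secondAssoc]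

theorem hasSum_opRightSmul {ι : Type*} {g : ι → H → H} {G : H → H}
    (h : ∀ y, HasSum (fun i => g i y) (G y)) (p : Octonion) (y : H) :
    HasSum (fun i => opRightSmul (g i) p y) (opRightSmul G p y) :=
  (h _).sub (((rmulR p).hasSum (h y)).sub (h _))

theorem opRightSmul_eq_sum (g : H →ₗ[ℝ] H) (p : Octonion) (y : H) :
    opRightSmul g p y = ∑ k, opRightSmul (fun x => p k • g x) (e k) y := by
  conv_lhs => rw [sum_smul_e p]
  simp only [opRightSmul, secondAssoc, map_sum, map_smul, LinearMap.sum_apply, LinearMap.smul_apply,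
    Finset.sum_sub_distrib]

end OctHilbertBimodule

variable {I : Type*} {x : I → H}

theorem IsWeakAssocOrthonormal.diagonal_rmul_real (hs : ∀ a, x a ∈ sliceCone H) {c : I → ℝ}
    {F : H →L[ℝ] H} (hF : ∀ y, HasSum (fun a => c a • sliceProj (x a) y) (F y)) :
    ∀ u ∈ octReal H, ∀ q, F (rmul u q) = rmul (F u) q := by
  intro u hu q
  refine (hF _).unique ?_
  have := (rmulR q).hasSum (hF u)
  simp only [map_smul, rmulR_apply, ← sliceProj_rmul_real (hs _) hu] at this
  exact this

/-- The octonionic combination of slice projections with bounded coefficients is a bounded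
para-linear operator. -/
theorem IsWeakAssocOrthonormal.exists_calculus [CompleteSpace H] (hx : IsWeakAssocOrthonormal x)
    (hs : ∀ a, x a ∈ sliceCone H) {f : I → Octonion} {C : ℝ} (hf : ∀ a, ‖f a‖ ≤ C) :
    ∃ F : Fin 8 → H →L[ℝ] H, (∀ k y, HasSum (fun a => f a k • sliceProj (x a) y) (F k y)) ∧
      IsParaLinear (∑ k, opRightSmulL (F k) (e k)) ∧
      ∀ y, HasSum (fun a => opRightSmul (sliceProj (x a)) (f a) y)
        ((∑ k, opRightSmulL (F k) (e k)) y) := by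
  have hfk : ∀ k a, |f a k| ≤ C := fun k a => (PiLp.norm_apply_le (f a) k).trans (hf a)
  choose F hF using fun k => hx.exists_diagonal (hfk k)
  refine ⟨F, hF, .of_rmul_real fun u hu q => ?_, fun y => ?_⟩
  · simp only [sum_apply, opRightSmulL_apply, map_sum, LinearMap.sum_apply]
    refine Finset.sum_congr rfl fun k _ => ?_
    exact opRightSmul_rmul_real (g := (F k : H →ₗ[ℝ] H))
      (IsWeakAssocOrthonormal.diagonal_rmul_real hs (hF k)) hu (e k) q
  · simp only [sum_apply, opRightSmulL_apply]
    have h : ∀ a, opRightSmul (sliceProj (x a)) (f a) y =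
        ∑ k, opRightSmul (fun y => f a k • sliceProj (x a) y) (e k) y :=
      fun a => opRightSmul_eq_sum (sliceProjLinear (x a)) (f a) y
    simp only [h]
    exact hasSum_sum fun k _ => hasSum_opRightSmul (hF k) (e k) y

/-- A diagonal operator with coefficients depending only on the eigenvalues acts as a scalar on
each eigenvector of `T`. -/
theorem IsWeakAssocBasis.diagonal_apply_eigen [CompleteSpace H] (hx : IsWeakAssocBasis x)
    (hs : ∀ a, x a ∈ sliceCone H) {T : H →L[ℝ] H} (hT : IsParaLinear T) (hself : IsSelfAdjoint T)
    {S : Set ℝ} {r : I → S} (hr : ∀ a, T (x a) = (r a : ℝ) • x a) {φ : S → ℝ} {F : H →L[ℝ] H}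
    (hF : ∀ y, HasSum (fun a => φ (r a) • sliceProj (x a) y) (F y)) {y : H} {l : S}
    (hy : T y = (l : ℝ) • y) : F y = φ l • y := by
  refine (hF y).unique ?_
  have h := (hx.hasSum_sliceProj hs y).const_smul (φ l)
  convert h using 2 with a
  by_cases hal : r a = l
  · rw [hal]
  · have h0 : oinner (x a) y = 0 := by
      refine ext_inner_left ℝ fun q => ?_
      rw [inner_oinner, inner_zero_right]
      have h1 : inner ℝ (T (rmul (x a) q)) y = inner ℝ (rmul (x a) q) (T y) :=
        hself.isSymmetric _ _
      rw [hx.map_rmul hs hT hr, hy, real_inner_smul_left, real_inner_smul_right, ← sub_eq_zero,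
        ← sub_mul] at h1
      exact (mul_eq_zero.1 h1).resolve_left (sub_ne_zero.2 fun h => hal (Subtype.ext h))
    rw [sliceProj, h0, map_zero, smul_zero, smul_zero]

/-- An arbitrary y is no eigenvector, but each term x'_a ⟨x'_a, y⟩ of its second expansion is;
applying F termwise gives F'. -/
theorem IsWeakAssocBasis.diagonal_unique [CompleteSpace H] (hx : IsWeakAssocBasis x)
    (hs : ∀ a, x a ∈ sliceCone H) {I' : Type*} {x' : I' → H} (hx' : IsWeakAssocBasis x')
    (hs' : ∀ a, x' a ∈ sliceCone H) {T : H →L[ℝ] H} (hT : IsParaLinear T) (hself : IsSelfAdjoint T)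
    {S : Set ℝ} {r : I → S} (hr : ∀ a, T (x a) = (r a : ℝ) • x a) {r' : I' → S}
    (hr' : ∀ a, T (x' a) = (r' a : ℝ) • x' a) {φ : S → ℝ} {F F' : H →L[ℝ] H}
    (hF : ∀ y, HasSum (fun a => φ (r a) • sliceProj (x a) y) (F y))
    (hF' : ∀ y, HasSum (fun a => φ (r' a) • sliceProj (x' a) y) (F' y)) : F = F' := by
  ext y
  have h := F.hasSum (hx'.hasSum_sliceProj hs' y)
  refine h.unique ?_
  convert hF' y using 2 with a
  exact hx.diagonal_apply_eigen hs hT hself hr hF (hx'.map_rmul hs' hT hr' a _)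

namespace SpectralBasis

variable {T : H →L[ℝ] H} {N Λ : Type*} (B : SpectralBasis T N Λ)

/-- The eigenvalues of a spectral basis, as points of the spectrum. -/
def label : N ⊕ Λ → octSpectrum T := Sum.elim B.lamSpec fun _ => ⟨0, Or.inr rfl⟩

theorem mem_sliceCone (a : N ⊕ Λ) : Sum.elim B.z B.w a ∈ sliceCone H := by
  rcases a with i | a
  · exact (B.strong_z i).1
  · exact (B.strong_w a).1

theorem map_eq_smul (a : N ⊕ Λ) :
    T (Sum.elim B.z B.w a) = (B.label a : ℝ) • Sum.elim B.z B.w a := by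
  rcases a with i | a
  · simp only [Sum.elim_inl, (B.strong_z i).2.2, ofReal_eq_smul, map_smul, rmul_one]
    rfl
  · simp only [Sum.elim_inr, (B.strong_w a).2.2, map_zero]
    exact (zero_smul ℝ _).symm

variable [CompleteSpace H]

theorem summable_sliceProj_w (y : H) : Summable fun a => sliceProj (B.w a) y := by
  have h := (B.isBasis.hasSum_sliceProj B.mem_sliceCone y).summable.comp_injective
    (Sum.inr_injective (α := N))
  simpa only [Function.comp_def, Sum.elim_inr] using h

theorem summable_opRightSmul_z {f : octSpectrum T → Octonion} {y G : H} (hG :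
    HasSum (fun a => opRightSmul (sliceProj (Sum.elim B.z B.w a)) (f (B.label a)) y) G) :
    Summable fun i => opRightSmul (sliceProj (B.z i)) (f (B.lamSpec i)) y := by
  have h := hG.summable.comp_injective (Sum.inl_injective (β := Λ))
  simpa only [Function.comp_def, Sum.elim_inl, label] using h

/-- ⊙ acts termwise on the series of P_0, so both parts of Φ(f) merge into one sum over `N ⊕ Λ`. -/
theorem rightCalculus_eq {f : octSpectrum T → Octonion} {G : H → H} (hG : ∀ y,
    HasSum (fun a => opRightSmul (sliceProj (Sum.elim B.z B.w a)) (f (B.label a)) y) (G y)) (y : H) :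
    B.rightCalculus f y = G y := by
  have h1 := B.summable_opRightSmul_z (hG y)
  have h2 := hasSum_opRightSmul (G := B.projZero)
    (fun y => (B.summable_sliceProj_w y).hasSum) (f ⟨0, Or.inr rfl⟩) y
  have h3 : HasSum (fun a => opRightSmul (sliceProj (Sum.elim B.z B.w a)) (f (B.label a)) y)
      ((∑' i, opRightSmul (sliceProj (B.z i)) (f (B.lamSpec i)) y) +
        opRightSmul B.projZero (f ⟨0, Or.inr rfl⟩) y) := by
    refine HasSum.sum ?_ ?_
    · simpa only [Function.comp_def, Sum.elim_inl, label] using h1.hasSum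
    · simpa only [Function.comp_def, Sum.elim_inr, label] using h2
  rw [rightCalculus, add_comm]
  exact h3.unique (hG y)

end SpectralBasis

end calculus

theorem mainTheorem11
    {H : Type*} [NormedAddCommGroup H] [InnerProductSpace ℝ H] [CompleteSpace H]
    [OctHilbertBimodule H]
    (T : H →L[ℝ] H) (hpara : IsParaLinear T) (hself : IsSelfAdjoint T)
    (hcompact : IsCompactOperator T)
    {N₁ Λ₁ N₂ Λ₂ : Type*} (B₁ : SpectralBasis T N₁ Λ₁) (B₂ : SpectralBasis T N₂ Λ₂)
    (f : octSpectrum T → Octonion) (hf : ∃ C : ℝ, ∀ q, ‖f q‖ ≤ C) :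
    B₁.CalculusWellDefined f ∧ B₂.CalculusWellDefined f ∧
      B₁.rightCalculus f = B₂.rightCalculus f := by
  obtain ⟨C, hC⟩ := hf
  obtain ⟨F₁, hF₁, hp₁, hs₁⟩ := B₁.isBasis.1.exists_calculus B₁.mem_sliceCone
    (f := fun a => f (B₁.label a)) fun a => hC _
  obtain ⟨F₂, hF₂, hp₂, hs₂⟩ := B₂.isBasis.1.exists_calculus B₂.mem_sliceCone
    (f := fun a => f (B₂.label a)) fun a => hC _
  have hF : F₁ = F₂ := funext fun k =>
    B₁.isBasis.diagonal_unique B₁.mem_sliceCone B₂.isBasis B₂.mem_sliceCone hpara hself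
      B₁.map_eq_smul B₂.map_eq_smul (φ := fun l => f l k) (hF₁ k) (hF₂ k)
  refine ⟨⟨B₁.summable_sliceProj_w, fun y => B₁.summable_opRightSmul_z (hs₁ y),
      _, hp₁, fun y => (B₁.rightCalculus_eq hs₁ y).symm⟩,
    ⟨B₂.summable_sliceProj_w, fun y => B₂.summable_opRightSmul_z (hs₂ y),
      _, hp₂, fun y => (B₂.rightCalculus_eq hs₂ y).symm⟩, funext fun y => ?_⟩
  rw [B₁.rightCalculus_eq hs₁, B₂.rightCalculus_eq hs₂, hF]
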